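/- Let $L_1,L_2,T>0$, $\Omega=(0,L_1)\times(0,L_2)\times(-1,1)$, $\nabla=(\partial_x,\partial_y)$, $\Delta=\partial_x^2+\partial_y^2$. All functions are periodic in $x,y,z$ with periods $L_1,L_2,2$; horizontal fields $u,b$ (with values in $\mathbb R^2$) are even in $z$, vertical components $u_3,b_3$ are odd in $z$. For such fields put $B(u,v)=(u\cdot\nabla)v+u_3\,\partial_z v$. An $H^1$ strong solution on $[0,T]$ of one of the systems below is a pair $(u,b)$ with $(u,b)\in C([0,T];H^1)\cap L^2(0,T;H^2)$ and $(\partial_t u,\partial_t b)\in L^2(0,T;L^2)$ for which there are $u_3,b_3$ and a pressure $p\in L^2(0,T;H^1)$ such that the equations hold almost everywhere (with weak derivatives); in every system $$\partial_z p=0,\qquad \nabla\cdot u+\partial_z u_3=0,\qquad \nabla\cdot b+\partial_z b_3=0 .$$ Let $\mu,\mu_1,\mu_2,\nu,\beta_u,\beta_b,h>0$ with $\mu_1\ne\mu_2$, and let $I_h$ be a linear operator on $L^2(\Omega)$, acting on vector fields componentwise, with $\|w-I_h w\|_2\le C_h^1h\|w\|_{H^1}$ for $w\in H^1$ and $\|I_h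 w\|_2\le C_h^2\|w\|_2$ for $w\in L^2$. Let $(u,b)$ be an $H^1$ strong solution on $[0,T]$ of the reference system $$\partial_t u+B(u,u)+\nabla p-B(b,b)-\mu\Delta u-\nu\partial_z^2u=0,\qquad \partial_t b+B(u,b)-B(b,u)-\mu\Delta b-\nu\partial_z^2 b=0,$$ and for $i=1,2$ let $(\tilde u_i,\tilde b_i)$ be an $H^1$ strong solution on $[0,T]$ of the assimilation system with viscosity $\mu_i$, $$\partial_t\tilde u_i+B(\tilde u_i,\tilde u_i)+\nabla\tilde p_i-B(\tilde b_i,\tilde b_i)-\mu_i\Delta\tilde u_i-\nu\partial_z^2\tilde u_i=-\beta_u\big(I_h(\tilde u_i)-I_h(u)\big),$$ $$\partial_t\tilde b_i+B(\tilde u_i,\tilde b_i)-B(\tilde b_i,\tilde u_i)-\mu_i\Delta\tilde b_i-\nu\partial_z^2\tilde b_i=-\beta_b\big(I_h(\tilde b_i)-I_h(b)\big).$$ Then the difference quotient system $$\partial_t\bar u+B(\bar u,\tilde u_1)+B(\tilde u_2,\bar u)+\nabla\bar p-B(\bar b,\tilde b_1)-B(\tilde b_2,\bar b)-\Delta\tilde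 u_1-\mu_2\Delta\bar u-\nu\partial_z^2\bar u=-\beta_uI_h(\bar u),$$ $$\partial_t\bar b+B(\bar u,\tilde b_1)+B(\tilde u_2,\bar b)-B(\bar b,\tilde u_1)-B(\tilde b_2,\bar u)-\Delta\tilde b_1-\mu_2\Delta\bar b-\nu\partial_z^2\bar b=-\beta_bI_h(\bar b),$$ together with $\partial_z\bar p=0$, $\nabla\cdot\bar u+\partial_z\bar u_3=0$, $\nabla\cdot\bar b+\partial_z\bar b_3=0$ and the initial values $$\bar u(0)=\frac{\tilde u_1(0)-\tilde u_2(0)}{\mu_1-\mu_2},\qquad \bar b(0)=\frac{\tilde b_1(0)-\tilde b_2(0)}{\mu_1-\mu_2},$$ has an $H^1$ strong solution $(\bar u,\bar b)$ on $[0,T]$, and it is unique in this class. It is $$\bar u=\frac{\tilde u_1-\tilde u_2}{\mu_1-\mu_2},\qquad \bar b=\frac{\tilde b_1-\tilde b_2}{\mu_1-\mu_2}.$$ -/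

import Mathlib

open MeasureTheory Set
open scoped ContDiff

noncomputable section

namespace PEM

/-- The basic periodic cell `Ω = (0, L₁) × (0, L₂) × (-1, 1)`; coordinates `0, 1, 2` are `x, y, z`. -/
def cell (L₁ L₂ : ℝ) : Set (Fin 3 → ℝ) :=
  Set.pi Set.univ fun i => Set.Ioo ((![0, 0, -1] : Fin 3 → ℝ) i) ((![L₁, L₂, 1] : Fin 3 → ℝ) i)

/-- Lebesgue measure on `Ω`. -/
abbrev cellMeasure (L₁ L₂ : ℝ) : Measure (Fin 3 → ℝ) := volume.restrict (cell L₁ L₂)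

/-- The real Hilbert space `L²(Ω)`. -/
abbrev LTwo (L₁ L₂ : ℝ) : Type := Lp ℝ 2 (cellMeasure L₁ L₂)

/-- Smooth functions on `ℝ³` with periods `L₁, L₂, 2` in `x, y, z`. -/
def IsPeriodicTest (L₁ L₂ : ℝ) (φ : (Fin 3 → ℝ) → ℝ) : Prop :=
  ContDiff ℝ ∞ φ ∧
    ∀ (i : Fin 3) (x : Fin 3 → ℝ), φ (x + Pi.single i ((![L₁, L₂, 2] : Fin 3 → ℝ) i)) = φ x

/-- `g = ∂ᵢ f` weakly, for the periodic extensions of `f, g ∈ L²(Ω)`. As the test functions are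
periodic and need not vanish on the boundary of `Ω`, this includes the periodic boundary condition:
`f` has weak derivatives in this sense iff `f` is in the periodic Sobolev space `H¹`. -/
def IsWeakDeriv {L₁ L₂ : ℝ} (i : Fin 3) (f g : LTwo L₁ L₂) : Prop :=
  ∀ φ : (Fin 3 → ℝ) → ℝ, IsPeriodicTest L₁ L₂ φ →
    ∫ x, f x * fderiv ℝ φ x (Pi.single i 1) ∂(cellMeasure L₁ L₂) =
      -∫ x, g x * φ x ∂(cellMeasure L₁ L₂)

/-- The reflection `(x, y, z) ↦ (x, y, -z)`. -/
def reflectZ (x : Fin 3 → ℝ) : Fin 3 → ℝ := Function.update x 2 (-x 2)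

/-- `f` is even in `z`. -/
def IsEvenZ {L₁ L₂ : ℝ} (f : LTwo L₁ L₂) : Prop :=
  ∀ᵐ x ∂(cellMeasure L₁ L₂), f (reflectZ x) = f x

/-- `f` is odd in `z`. -/
def IsOddZ {L₁ L₂ : ℝ} (f : LTwo L₁ L₂) : Prop :=
  ∀ᵐ x ∂(cellMeasure L₁ L₂), f (reflectZ x) = -f x

/-- The linear interpolation operator `I_h` (it acts on vector fields componentwise):
`‖w - I_h w‖₂ ≤ c₁ h ‖w‖_{H¹}` for `w ∈ H¹` and `‖I_h w‖₂ ≤ c₂ ‖w‖₂` for `w ∈ L²`. -/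
structure IsInterpolant {L₁ L₂ : ℝ} (c₁ c₂ h : ℝ) (I : LTwo L₁ L₂ →ₗ[ℝ] LTwo L₁ L₂) : Prop where
  approx : ∀ (w : LTwo L₁ L₂) (g : Fin 3 → LTwo L₁ L₂), (∀ i, IsWeakDeriv i w (g i)) →
    ‖w - I w‖ ≤ c₁ * h * Real.sqrt (‖w‖ ^ 2 + ∑ i, ‖g i‖ ^ 2)
  bounded : ∀ w : LTwo L₁ L₂, ‖I w‖ ≤ c₂ * ‖w‖

/-- A scalar function on `[0, T] × Ω`, periodic and even in `z`, of the regularity of `H¹` strong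
solutions, `f ∈ C([0, T]; H¹) ∩ L²(0, T; H²)` and `∂ₜ f ∈ L²(0, T; L²)`, together with
its (uniquely determined) weak derivatives: `grad t k = ∂ₖ f(t)`, `hess t j k = ∂ₖ ∂ⱼ f(t)`. -/
structure StrongScalar (L₁ L₂ T : ℝ) where
  val : ℝ → LTwo L₁ L₂
  grad : ℝ → Fin 3 → LTwo L₁ L₂
  hess : ℝ → Fin 3 → Fin 3 → LTwo L₁ L₂
  dt : ℝ → LTwo L₁ L₂
  even : ∀ t ∈ Icc 0 T, IsEvenZ (val t)
  val_continuousOn : ContinuousOn val (Icc 0 T)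
  grad_continuousOn : ∀ k, ContinuousOn (fun t => grad t k) (Icc 0 T)
  isWeakDeriv_grad : ∀ t ∈ Icc 0 T, ∀ k, IsWeakDeriv k (val t) (grad t k)
  hess_memLp : ∀ j k, MemLp (fun t => hess t j k) 2 (volume.restrict (Ioo 0 T))
  isWeakDeriv_hess : ∀ᵐ t ∂(volume.restrict (Ioo 0 T)),
    ∀ j k, IsWeakDeriv k (grad t j) (hess t j k)
  dt_memLp : MemLp dt 2 (volume.restrict (Ioo 0 T))
  val_eq_integral : ∀ t ∈ Icc 0 T, val t = val 0 + ∫ s in (0 : ℝ)..t, dt s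

/-- The unknowns on `[0, T] × Ω`: horizontal velocity `u` and magnetic field `b` (even in `z`, of
`H¹` strong regularity), vertical components `u₃, b₃` (odd in `z`) and the
pressure `p ∈ L²(0, T; H¹)` with its weak gradient; all are periodic. -/
structure Fields (L₁ L₂ T : ℝ) where
  u : Fin 2 → StrongScalar L₁ L₂ T
  b : Fin 2 → StrongScalar L₁ L₂ T
  u₃ : ℝ → LTwo L₁ L₂
  b₃ : ℝ → LTwo L₁ L₂
  u₃_odd : ∀ t ∈ Icc 0 T, IsOddZ (u₃ t)
  b₃_odd : ∀ t ∈ Icc 0 T, IsOddZ (b₃ t)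
  p : ℝ → LTwo L₁ L₂
  gradp : ℝ → Fin 3 → LTwo L₁ L₂
  p_memLp : MemLp p 2 (volume.restrict (Ioo 0 T))
  gradp_memLp : ∀ k, MemLp (fun t => gradp t k) 2 (volume.restrict (Ioo 0 T))
  isWeakDeriv_gradp : ∀ᵐ t ∂(volume.restrict (Ioo 0 T)), ∀ k, IsWeakDeriv k (p t) (gradp t k)

variable {L₁ L₂ T : ℝ}

/-- The three-dimensional velocity `(u₁, u₂, u₃)` at time `t`. -/
def Fields.vel (F : Fields L₁ L₂ T) (t : ℝ) : Fin 3 → LTwo L₁ L₂ :=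
  ![(F.u 0).val t, (F.u 1).val t, F.u₃ t]

/-- The three-dimensional magnetic field `(b₁, b₂, b₃)` at time `t`. -/
def Fields.mag (F : Fields L₁ L₂ T) (t : ℝ) : Fin 3 → LTwo L₁ L₂ :=
  ![(F.b 0).val t, (F.b 1).val t, F.b₃ t]

/-- The transport term `w₁ ∂ₓ f + w₂ ∂_y f + w₃ ∂_z f` at time `t`, that is, a component of
`B(w, f) = (w · ∇) f + w₃ ∂_z f`. -/
def transport (w : Fin 3 → LTwo L₁ L₂) (f : StrongScalar L₁ L₂ T) (t : ℝ) (x : Fin 3 → ℝ) : ℝ :=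
  ∑ k, w k x * f.grad t k x

/-- The horizontal Laplacian `Δ f = ∂ₓ² f + ∂_y² f`. -/
def lapH (f : StrongScalar L₁ L₂ T) (t : ℝ) (x : Fin 3 → ℝ) : ℝ :=
  f.hess t 0 0 x + f.hess t 1 1 x

/-- `∂_z² f`. -/
def dzz (f : StrongScalar L₁ L₂ T) (t : ℝ) (x : Fin 3 → ℝ) : ℝ :=
  f.hess t 2 2 x

/-- The constraints shared by all the systems:
`∂_z p = 0`, `∇ · u + ∂_z u₃ = 0` and `∇ · b + ∂_z b₃ = 0`. -/
structure Fields.IsConstrained (F : Fields L₁ L₂ T) : Prop where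
  pressure : ∀ᵐ t ∂(volume.restrict (Ioo 0 T)), F.gradp t 2 = 0
  div_u : ∀ t ∈ Icc 0 T, IsWeakDeriv 2 (F.u₃ t) (-((F.u 0).grad t 0 + (F.u 1).grad t 1))
  div_b : ∀ t ∈ Icc 0 T, IsWeakDeriv 2 (F.b₃ t) (-((F.b 0).grad t 0 + (F.b 1).grad t 1))

/-- `F` is an `H¹` strong solution on `[0, T]` of the primitive equations with magnetic field, with
horizontal viscosity and magnetic diffusivity `μ` and vertical ones `ν`. -/
structure IsReferenceSolution (μ ν : ℝ) (F : Fields L₁ L₂ T) : Prop where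
  constrained : F.IsConstrained
  momentum : ∀ᵐ t ∂(volume.restrict (Ioo 0 T)), ∀ i : Fin 2, ∀ᵐ x ∂(cellMeasure L₁ L₂),
    (F.u i).dt t x + transport (F.vel t) (F.u i) t x + F.gradp t i.castSucc x
      - transport (F.mag t) (F.b i) t x
      - μ * lapH (F.u i) t x - ν * dzz (F.u i) t x = 0
  induction : ∀ᵐ t ∂(volume.restrict (Ioo 0 T)), ∀ i : Fin 2, ∀ᵐ x ∂(cellMeasure L₁ L₂),
    (F.b i).dt t x + transport (F.vel t) (F.b i) t x - transport (F.mag t) (F.u i) t x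
      - μ * lapH (F.b i) t x - ν * dzz (F.b i) t x = 0

/-- `F` is an `H¹` strong solution on `[0, T]` of the assimilation system with viscosities `μ, ν`,
nudging parameters `βu, βb`, interpolation operator `I` and observed reference fields `R`. -/
structure IsAssimilationSolution (μ ν βu βb : ℝ) (I : LTwo L₁ L₂ →ₗ[ℝ] LTwo L₁ L₂)
    (R F : Fields L₁ L₂ T) : Prop where
  constrained : F.IsConstrained
  momentum : ∀ᵐ t ∂(volume.restrict (Ioo 0 T)), ∀ i : Fin 2, ∀ᵐ x ∂(cellMeasure L₁ L₂),
    (F.u i).dt t x + transport (F.vel t) (F.u i) t x + F.gradp t i.castSucc x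
      - transport (F.mag t) (F.b i) t x
      - μ * lapH (F.u i) t x - ν * dzz (F.u i) t x
      = -βu * (I ((F.u i).val t) x - I ((R.u i).val t) x)
  induction : ∀ᵐ t ∂(volume.restrict (Ioo 0 T)), ∀ i : Fin 2, ∀ᵐ x ∂(cellMeasure L₁ L₂),
    (F.b i).dt t x + transport (F.vel t) (F.b i) t x - transport (F.mag t) (F.u i) t x
      - μ * lapH (F.b i) t x - ν * dzz (F.b i) t x
      = -βb * (I ((F.b i).val t) x - I ((R.b i).val t) x)

/-- `D` is an `H¹` strong solution on `[0, T]` of the difference quotient system built from the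
assimilation solutions `F₁` and `F₂` for the viscosities `μ₁` and `μ₂`; its initial values are the
difference quotients of theirs. -/
structure IsDifferenceQuotientSolution (μ₁ μ₂ ν βu βb : ℝ) (I : LTwo L₁ L₂ →ₗ[ℝ] LTwo L₁ L₂)
    (F₁ F₂ D : Fields L₁ L₂ T) : Prop where
  constrained : D.IsConstrained
  momentum : ∀ᵐ t ∂(volume.restrict (Ioo 0 T)), ∀ i : Fin 2, ∀ᵐ x ∂(cellMeasure L₁ L₂),
    (D.u i).dt t x + transport (D.vel t) (F₁.u i) t x + transport (F₂.vel t) (D.u i) t x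
      + D.gradp t i.castSucc x
      - transport (D.mag t) (F₁.b i) t x - transport (F₂.mag t) (D.b i) t x
      - lapH (F₁.u i) t x - μ₂ * lapH (D.u i) t x - ν * dzz (D.u i) t x
      = -βu * I ((D.u i).val t) x
  induction : ∀ᵐ t ∂(volume.restrict (Ioo 0 T)), ∀ i : Fin 2, ∀ᵐ x ∂(cellMeasure L₁ L₂),
    (D.b i).dt t x + transport (D.vel t) (F₁.b i) t x + transport (F₂.vel t) (D.b i) t x
      - transport (D.mag t) (F₁.u i) t x - transport (F₂.mag t) (D.u i) t x
      - lapH (F₁.b i) t x - μ₂ * lapH (D.b i) t x - ν * dzz (D.b i) t x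
      = -βb * I ((D.b i).val t) x
  initial_u : ∀ i, (D.u i).val 0 = (μ₁ - μ₂)⁻¹ • ((F₁.u i).val 0 - (F₂.u i).val 0)
  initial_b : ∀ i, (D.b i).val 0 = (μ₁ - μ₂)⁻¹ • ((F₁.b i).val 0 - (F₂.b i).val 0)

end PEM

end

noncomputable section

namespace PEM

open Filter Topology

/-! ### Fourier series on the periodic cell -/

/-! Existence is algebra. Put c = (μ₁ - μ₂)⁻¹ and take c times the difference of the two
assimilation solutions. The identities B(u₁,v₁) - B(u₂,v₂) = B(u₁-u₂,v₁) + B(u₂,v₁-v₂) and μ₁Δu₁ -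
μ₂Δu₂ = (μ₁-μ₂)Δu₁ + μ₂Δ(u₁-u₂) turn the difference of their equations into the difference quotient
system. The observed reference fields drop out because `I` is linear; regularity, parity and the
constraints are linear as well.

Uniqueness is an energy estimate. The difference of two solutions solves a linear homogeneous system
with zero initial values, which is paired in L² with the difference itself. The pressure does no
work, since ∂_z p = 0 and the horizontal divergence is a z-derivative. Transport by the second
assimilation solution is skew-symmetric; its magnetic part cancels between the momentum and the
induction equation. Nudging costs a multiple of the energy because `I` is bounded on L². What
remains are the terms ∫ (w·∇U)·u, with w the difference field and U a component of the first
assimilation solution.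

The difficulty is the vertical component of w: it is known only through the divergence constraint,
so it is controlled in L² together with its z-derivative but with no horizontal derivative.
`trilinear_estimate` asks for exactly this: the three factors need one derivative each, in z, y and
x respectively. It holds because |f|² is bounded by an integral along a line parallel to an axis,
and the square roots of three such integrals, each independent of one coordinate, are multiplied by
the Loomis–Whitney inequality. Oddness in z gives ‖w₃‖ ≤ ‖∂_z w₃‖ (`IsOddZ.norm_le`). Young's
inequality then absorbs the gradients into the dissipation (`energy_inequality`) and leaves a
coefficient ‖∂U‖²(‖∂U‖ + ‖∂_y∂U‖)², which is integrable in time because ∂U is bounded in L² and its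
derivatives are square integrable in time. The time derivatives are integrable in time with values
in L², so the energy is absolutely continuous and Grönwall's argument `eq_zero_of_inner_le` applies.

Density comes from Fourier series. Partial sums are smooth periodic test functions and commute with
weak derivatives, so weak derivatives are strong ones, integration by parts holds, and the
cancellations pass to the limit. -/

/-- The side lengths of the periodic cell. -/
def side (L₁ L₂ : ℝ) : Fin 3 → ℝ := ![L₁, L₂, 2]

/-- The lower corner of the periodic cell. -/
def corner : Fin 3 → ℝ := ![0, 0, -1]

/-- The one-dimensional factors of the measure on the cell. -/
def edgeMeasure (L₁ L₂ : ℝ) (i : Fin 3) : Measure ℝ :=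
  volume.restrict (Ioo (corner i) (corner i + side L₁ L₂ i))

instance (L₁ L₂ : ℝ) (i : Fin 3) : IsFiniteMeasure (edgeMeasure L₁ L₂ i) := by
  unfold edgeMeasure; infer_instance

lemma corner_add_side (L₁ L₂ : ℝ) (i : Fin 3) :
    corner i + side L₁ L₂ i = (![L₁, L₂, 1] : Fin 3 → ℝ) i := by
  fin_cases i <;> norm_num [corner, side]

lemma side_pos {L₁ L₂ : ℝ} (hL₁ : 0 < L₁) (hL₂ : 0 < L₂) (i : Fin 3) : 0 < side L₁ L₂ i := by
  fin_cases i <;> simp [side, hL₁, hL₂]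

lemma cell_eq_pi (L₁ L₂ : ℝ) :
    cell L₁ L₂ = Set.pi univ fun i => Ioo (corner i) (corner i + side L₁ L₂ i) := by
  simp only [corner_add_side]; rfl

lemma cellMeasure_eq_pi (L₁ L₂ : ℝ) : cellMeasure L₁ L₂ = Measure.pi (edgeMeasure L₁ L₂) := by
  unfold cellMeasure
  rw [cell_eq_pi, volume_pi, Measure.restrict_pi_pi]; rfl

instance (L₁ L₂ : ℝ) : IsFiniteMeasure (cellMeasure L₁ L₂) := by
  rw [cellMeasure_eq_pi]; infer_instance

lemma measurableSet_cell (L₁ L₂ : ℝ) : MeasurableSet (cell L₁ L₂) :=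
  MeasurableSet.univ_pi fun _ => measurableSet_Ioo

/-- The covering map from `ℝ³` onto the unit torus that is injective on the periodic cell. -/
def toTorus (L₁ L₂ : ℝ) (x : Fin 3 → ℝ) : UnitAddTorus (Fin 3) :=
  fun i => ((x i / side L₁ L₂ i : ℝ) : UnitAddCircle)

/-- A section of `toTorus` with values in the closure of the cell. -/
def ofTorus (L₁ L₂ : ℝ) (t : UnitAddTorus (Fin 3)) : Fin 3 → ℝ :=
  fun i => side L₁ L₂ i *
    (UnitAddTorus.measurableEquivPiIoc (fun i => corner i / side L₁ L₂ i) t).1 i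

lemma measurable_ofTorus (L₁ L₂ : ℝ) : Measurable (ofTorus L₁ L₂) := by
  unfold ofTorus
  refine measurable_pi_lambda _ fun i => Measurable.const_mul ?_ _
  exact (measurable_pi_apply i).comp (measurable_subtype_coe.comp (MeasurableEquiv.measurable _))

lemma ofTorus_toTorus {L₁ L₂ : ℝ} (hL₁ : 0 < L₁) (hL₂ : 0 < L₂) {x : Fin 3 → ℝ}
    (hx : x ∈ cell L₁ L₂) : ofTorus L₁ L₂ (toTorus L₁ L₂ x) = x := by
  have hs := side_pos hL₁ hL₂
  rw [cell_eq_pi] at hx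
  have hx' : ∀ i, x i / side L₁ L₂ i ∈
      Ioc (corner i / side L₁ L₂ i) (corner i / side L₁ L₂ i + 1) := by
    intro i
    have h := hx i (mem_univ i)
    have h2 : corner i / side L₁ L₂ i + 1 = (corner i + side L₁ L₂ i) / side L₁ L₂ i := by
      field_simp [(hs i).ne']
    rw [h2]
    exact ⟨div_lt_div_of_pos_right h.1 (hs i), (div_lt_div_of_pos_right h.2 (hs i)).le⟩
  have key : toTorus L₁ L₂ x = (UnitAddTorus.measurableEquivPiIoc
      (fun i => corner i / side L₁ L₂ i)).symm ⟨fun i => x i / side L₁ L₂ i, hx'⟩ := rfl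
  funext i
  unfold ofTorus
  rw [key, MeasurableEquiv.apply_symm_apply]
  have := (hs i).ne'
  field_simp

/-- Division by ℓ wraps the edge once around the unit circle. The factor ℓ⁻¹ turns its length into
Haar probability measure; the missing endpoint is null. -/
lemma measurePreserving_div_circle (a : ℝ) {ℓ : ℝ} (hℓ : 0 < ℓ) :
    MeasurePreserving (fun x : ℝ => ((x / ℓ : ℝ) : UnitAddCircle))
      ((ENNReal.ofReal ℓ)⁻¹ • volume.restrict (Ioo a (a + ℓ))) AddCircle.haarAddCircle := by
  have h1 := AddCircle.measurePreserving_mk 1 (a / ℓ)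
  have h2 : MeasurePreserving (fun x : ℝ => x / ℓ)
      ((ENNReal.ofReal ℓ)⁻¹ • volume.restrict (Ioo a (a + ℓ)))
      (volume.restrict (Ioc (a / ℓ) (a / ℓ + 1))) := by
    refine ⟨by fun_prop, ?_⟩
    have hm : Measure.map (fun x : ℝ => x / ℓ) volume = ENNReal.ofReal ℓ • volume := by
      have := Real.map_volume_mul_right (a := ℓ⁻¹) (inv_ne_zero hℓ.ne')
      simpa [div_eq_mul_inv, abs_of_pos hℓ] using this
    have hpre : (fun x : ℝ => x / ℓ) ⁻¹' (Ioo (a / ℓ) (a / ℓ + 1)) = Ioo a (a + ℓ) := by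
      ext x
      have h2 : a / ℓ + 1 = (a + ℓ) / ℓ := by field_simp
      simp only [mem_preimage, mem_Ioo, h2]
      rw [div_lt_div_iff_of_pos_right hℓ, div_lt_div_iff_of_pos_right hℓ]
    rw [Measure.map_smul, ← hpre, ← Measure.restrict_map (by fun_prop) measurableSet_Ioo, hm,
      Measure.restrict_smul, smul_smul, ENNReal.inv_mul_cancel (by simpa using hℓ) (by simp),
      one_smul, restrict_Ioo_eq_restrict_Ioc]
  have h3 := h1.comp h2
  rw [AddCircle.volume_eq_smul_haarAddCircle, ENNReal.ofReal_one, one_smul] at h3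
  exact h3

lemma measurePreserving_toTorus {L₁ L₂ : ℝ} (hL₁ : 0 < L₁) (hL₂ : 0 < L₂) :
    MeasurePreserving (toTorus L₁ L₂)
      ((∏ i, (ENNReal.ofReal (side L₁ L₂ i))⁻¹) • cellMeasure L₁ L₂)
      (Measure.pi fun _ => AddCircle.haarAddCircle) := by
  have hs := side_pos hL₁ hL₂
  have : ∀ i, IsFiniteMeasure ((ENNReal.ofReal (side L₁ L₂ i))⁻¹ • edgeMeasure L₁ L₂ i) := by
    intro i
    have : (ENNReal.ofReal (side L₁ L₂ i))⁻¹ ≠ ⊤ := by simpa using hs i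
    exact Measure.smul_finite _ this
  have h := measurePreserving_pi (fun i => (ENNReal.ofReal (side L₁ L₂ i))⁻¹ • edgeMeasure L₁ L₂ i)
    (fun _ : Fin 3 => (AddCircle.haarAddCircle : Measure UnitAddCircle))
    (fun i => measurePreserving_div_circle (corner i) (hs i))
  have hpi : (∏ i, (ENNReal.ofReal (side L₁ L₂ i))⁻¹) • cellMeasure L₁ L₂ =
      Measure.pi fun i => (ENNReal.ofReal (side L₁ L₂ i))⁻¹ • edgeMeasure L₁ L₂ i := by
    rw [cellMeasure_eq_pi]
    symm
    refine Measure.pi_eq fun s _ => ?_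
    simp [Finset.prod_mul_distrib]
  rw [hpi]
  exact h

/-- The volume of the periodic cell. -/
def cellVol (L₁ L₂ : ℝ) : ℝ := ∏ i, side L₁ L₂ i

lemma cellVol_pos {L₁ L₂ : ℝ} (hL₁ : 0 < L₁) (hL₂ : 0 < L₂) : 0 < cellVol L₁ L₂ :=
  Finset.prod_pos fun i _ => side_pos hL₁ hL₂ i

lemma prod_inv_ofReal_side {L₁ L₂ : ℝ} (hL₁ : 0 < L₁) (hL₂ : 0 < L₂) :
    ∏ i, (ENNReal.ofReal (side L₁ L₂ i))⁻¹ = ENNReal.ofReal (cellVol L₁ L₂)⁻¹ := by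
  have hs := side_pos hL₁ hL₂
  rw [cellVol, ← Finset.prod_inv_distrib, ENNReal.ofReal_prod_of_nonneg]
  · exact Finset.prod_congr rfl fun i _ => (ENNReal.ofReal_inv_of_pos (hs i)).symm
  · exact fun i _ => (inv_pos.2 (hs i)).le

/-- The phase of the Fourier mode `k`. -/
def phase (L₁ L₂ : ℝ) (k : Fin 3 → ℤ) (x : Fin 3 → ℝ) : ℝ :=
  ∑ i, 2 * Real.pi * k i / side L₁ L₂ i * x i

/-- The partial sum over the modes in `s` of the real Fourier series of `f`. -/
def fourierSum {L₁ L₂ : ℝ} (s : Finset (Fin 3 → ℤ)) (f : LTwo L₁ L₂) (x : Fin 3 → ℝ) : ℝ :=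
  ∑ k ∈ s, (cellVol L₁ L₂)⁻¹ *
    ((∫ y, f y * Real.cos (phase L₁ L₂ k y) ∂cellMeasure L₁ L₂) * Real.cos (phase L₁ L₂ k x) +
      (∫ y, f y * Real.sin (phase L₁ L₂ k y) ∂cellMeasure L₁ L₂) * Real.sin (phase L₁ L₂ k x))

lemma mFourier_toTorus (L₁ L₂ : ℝ) (k : Fin 3 → ℤ) (x : Fin 3 → ℝ) :
    UnitAddTorus.mFourier k (toTorus L₁ L₂ x) = Complex.exp (phase L₁ L₂ k x * Complex.I) := by
  simp only [UnitAddTorus.mFourier, toTorus, ContinuousMap.coe_mk, fourier_coe_apply, phase]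
  rw [← Complex.exp_sum]
  congr 1
  push_cast
  rw [Finset.sum_mul]
  refine Finset.sum_congr rfl fun i _ => ?_
  ring

lemma phase_neg (L₁ L₂ : ℝ) (k : Fin 3 → ℤ) (x : Fin 3 → ℝ) :
    phase L₁ L₂ (-k) x = -phase L₁ L₂ k x := by
  simp only [phase, ← Finset.sum_neg_distrib, Pi.neg_apply]
  refine Finset.sum_congr rfl fun i _ => ?_
  push_cast; ring

lemma contDiff_phase (L₁ L₂ : ℝ) (k : Fin 3 → ℤ) {n : WithTop ℕ∞} :
    ContDiff ℝ n (phase L₁ L₂ k) := by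
  unfold phase; fun_prop

@[fun_prop]
lemma continuous_phase (L₁ L₂ : ℝ) (k : Fin 3 → ℤ) : Continuous (phase L₁ L₂ k) :=
  (contDiff_phase L₁ L₂ k (n := 0)).continuous

lemma integrable_mul_of_continuous_bdd {L₁ L₂ : ℝ} (f : LTwo L₁ L₂) {g : (Fin 3 → ℝ) → ℝ}
    (hg : Continuous g) {C : ℝ} (hC : ∀ x, |g x| ≤ C) :
    Integrable (fun y => f y * g y) (cellMeasure L₁ L₂) :=
  ((Lp.memLp f).integrable (by norm_num)).mul_bdd (c := C) hg.aestronglyMeasurable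
    (Eventually.of_forall hC)

/-- The lift of `f ∈ L²(Ω)` to a complex function on the unit torus. -/
def torusLift {L₁ L₂ : ℝ} (f : LTwo L₁ L₂) (t : UnitAddTorus (Fin 3)) : ℂ :=
  (f (ofTorus L₁ L₂ t) : ℂ)

lemma measurable_torusLift {L₁ L₂ : ℝ} (f : LTwo L₁ L₂) : Measurable (torusLift f) :=
  Complex.measurable_ofReal.comp
    ((Lp.stronglyMeasurable f).measurable.comp (measurable_ofTorus L₁ L₂))

lemma torusLift_toTorus {L₁ L₂ : ℝ} (hL₁ : 0 < L₁) (hL₂ : 0 < L₂) (f : LTwo L₁ L₂) :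
    ∀ᵐ x ∂cellMeasure L₁ L₂, torusLift f (toTorus L₁ L₂ x) = f x := by
  filter_upwards [ae_restrict_mem (measurableSet_cell L₁ L₂)] with x hx
  rw [torusLift, ofTorus_toTorus hL₁ hL₂ hx]

lemma memLp_torusLift {L₁ L₂ : ℝ} (hL₁ : 0 < L₁) (hL₂ : 0 < L₂) (f : LTwo L₁ L₂) :
    MemLp (torusLift f) 2
      (Measure.pi fun _ : Fin 3 => (AddCircle.haarAddCircle : Measure UnitAddCircle)) := by
  have hmp := measurePreserving_toTorus hL₁ hL₂
  rw [← hmp.map_eq, memLp_map_measure_iff (measurable_torusLift f).aestronglyMeasurable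
    hmp.measurable.aemeasurable, prod_inv_ofReal_side hL₁ hL₂]
  refine MemLp.smul_measure ?_ (by simp)
  exact (Lp.memLp f).ofReal.ae_eq ((torusLift_toTorus hL₁ hL₂ f).mono fun x hx => hx.symm)

/-- Translates the complex Fourier coefficients on the torus into the real cosine and sine integrals
of `fourierSum`. -/
lemma integral_mFourier_mul_torusLift {L₁ L₂ : ℝ} (hL₁ : 0 < L₁) (hL₂ : 0 < L₂)
    (f : LTwo L₁ L₂) (k : Fin 3 → ℤ) :
    ∫ t, UnitAddTorus.mFourier (-k) t • torusLift f t
      ∂(Measure.pi fun _ : Fin 3 => (AddCircle.haarAddCircle : Measure UnitAddCircle)) =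
    (cellVol L₁ L₂)⁻¹ *
      ((∫ y, f y * Real.cos (phase L₁ L₂ k y) ∂cellMeasure L₁ L₂ : ℝ) -
      (∫ y, f y * Real.sin (phase L₁ L₂ k y) ∂cellMeasure L₁ L₂ : ℝ) * Complex.I) := by
  have hmp := measurePreserving_toTorus hL₁ hL₂
  have hmeas : Measurable fun t => UnitAddTorus.mFourier (-k) t • torusLift f t :=
    (map_continuous (UnitAddTorus.mFourier (-k))).measurable.smul (measurable_torusLift f)
  rw [← hmp.map_eq, integral_map hmp.measurable.aemeasurable hmeas.aestronglyMeasurable,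
    prod_inv_ofReal_side hL₁ hL₂, integral_smul_measure,
    ENNReal.toReal_ofReal (inv_pos.2 (cellVol_pos hL₁ hL₂)).le]
  rw [Complex.real_smul, Complex.ofReal_inv]
  congr 1
  have hc := integrable_mul_of_continuous_bdd f (g := fun y => Real.cos (phase L₁ L₂ k y))
    (by fun_prop) (fun _ => Real.abs_cos_le_one _)
  have hs := integrable_mul_of_continuous_bdd f (g := fun y => Real.sin (phase L₁ L₂ k y))
    (by fun_prop) (fun _ => Real.abs_sin_le_one _)
  rw [← integral_complex_ofReal, ← integral_complex_ofReal, ← integral_mul_const,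
    ← integral_sub hc.ofReal (hs.ofReal.mul_const _)]
  refine integral_congr_ae ?_
  filter_upwards [torusLift_toTorus hL₁ hL₂ f] with x hx
  rw [hx, mFourier_toTorus, phase_neg, Complex.exp_mul_I]
  push_cast
  rw [Complex.cos_neg, Complex.sin_neg, smul_eq_mul]
  ring

/-- `fourierSum` is the real part of the pulled-back complex series on the torus, where L²
convergence is known; the change of measure only contributes a constant factor to the norm. -/
lemma tendsto_fourierSum {L₁ L₂ : ℝ} (hL₁ : 0 < L₁) (hL₂ : 0 < L₂) (f : LTwo L₁ L₂) :
    Tendsto (fun s => eLpNorm (fun x => fourierSum s f x - f x) 2 (cellMeasure L₁ L₂))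
      atTop (𝓝 0) := by
  have hmp := measurePreserving_toTorus hL₁ hL₂
  set π := Measure.pi fun _ : Fin 3 => (AddCircle.haarAddCircle : Measure UnitAddCircle) with hπ
  have hF : MemLp (torusLift f) 2 π := memLp_torusLift hL₁ hL₂ f
  set S : Finset (Fin 3 → ℤ) → UnitAddTorus (Fin 3) → ℂ := fun s t =>
    ∑ k ∈ s, UnitAddTorus.mFourierCoeff (torusLift f) k * UnitAddTorus.mFourier k t with hS
  have hsum := UnitAddTorus.hasSum_mFourier_series_L2 (d := Fin 3) hF.toLp
  have h1 : Tendsto (fun s => eLpNorm (S s - torusLift f) 2 π) atTop (𝓝 0) := by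
    refine ((Lp.tendsto_Lp_iff_tendsto_eLpNorm _ _ hF).1 hsum).congr fun s => ?_
    refine eLpNorm_congr_ae (EventuallyEq.sub ?_ EventuallyEq.rfl)
    have hc : ∀ k, UnitAddTorus.mFourierCoeff hF.toLp k =
        UnitAddTorus.mFourierCoeff (torusLift f) k := fun k => by
      refine integral_congr_ae ?_
      filter_upwards [hF.coeFn_toLp] with t ht
      rw [ht]
    have hl : ∑ k ∈ s, UnitAddTorus.mFourierCoeff hF.toLp k • UnitAddTorus.mFourierLp 2 k =
        ContinuousMap.toLp (E := ℂ) 2 π ℂ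
          (∑ k ∈ s, UnitAddTorus.mFourierCoeff (torusLift f) k • UnitAddTorus.mFourier k) := by
      rw [map_sum]
      exact Finset.sum_congr rfl fun k _ => by rw [hc, map_smul]; rfl
    rw [hl]
    refine (ContinuousMap.coeFn_toLp π _).trans (Eventually.of_forall fun t => ?_)
    simp [hS]
  have h2 : ∀ s x, fourierSum s f x = (S s (toTorus L₁ L₂ x)).re := fun s x => by
    simp only [hS, fourierSum, Complex.re_sum]
    refine Finset.sum_congr rfl fun k _ => ?_
    rw [mFourier_toTorus, Complex.exp_mul_I, ← Complex.ofReal_cos, ← Complex.ofReal_sin]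
    have := integral_mFourier_mul_torusLift hL₁ hL₂ f k
    change UnitAddTorus.mFourierCoeff (torusLift f) k = _ at this
    rw [this]
    simp only [Complex.mul_re, Complex.mul_im, Complex.sub_re,
      Complex.sub_im, Complex.add_re, Complex.add_im, Complex.ofReal_re, Complex.ofReal_im,
      Complex.I_re, Complex.I_im]
    ring
  have hc := inv_pos.2 (cellVol_pos hL₁ hL₂)
  have h3 : ∀ s, eLpNorm (S s - torusLift f) 2 π =
      ENNReal.ofReal (cellVol L₁ L₂)⁻¹ ^ (1 / 2 : ℝ) *
        eLpNorm (fun x => S s (toTorus L₁ L₂ x) - f x) 2 (cellMeasure L₁ L₂) := fun s => by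
    have hSm : Measurable (S s) := Finset.measurable_sum _ fun k _ =>
      (map_continuous (UnitAddTorus.mFourier k)).measurable.const_mul _
    rw [← eLpNorm_comp_measurePreserving
      (hSm.sub (measurable_torusLift f)).aestronglyMeasurable hmp,
      prod_inv_ofReal_side hL₁ hL₂, eLpNorm_smul_measure_of_ne_top (by simp), smul_eq_mul]
    congr 1
    · norm_num
    refine eLpNorm_congr_ae ?_
    filter_upwards [torusLift_toTorus hL₁ hL₂ f] with x hx
    simp [hx]
  have hA0 : ENNReal.ofReal (cellVol L₁ L₂)⁻¹ ^ (1 / 2 : ℝ) ≠ 0 := by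
    rw [ne_eq, ENNReal.rpow_eq_zero_iff]
    simpa using cellVol_pos hL₁ hL₂
  have hAt : ENNReal.ofReal (cellVol L₁ L₂)⁻¹ ^ (1 / 2 : ℝ) ≠ ⊤ :=
    ENNReal.rpow_ne_top_of_nonneg (by norm_num) (by simp)
  have h4 : Tendsto (fun s => eLpNorm (fun x => S s (toTorus L₁ L₂ x) - f x) 2
      (cellMeasure L₁ L₂)) atTop (𝓝 0) := by
    have h5 := ENNReal.Tendsto.const_mul (a := (ENNReal.ofReal (cellVol L₁ L₂)⁻¹ ^ (1 / 2 : ℝ))⁻¹)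
      h1 (Or.inr (ENNReal.inv_ne_top.2 hA0))
    rw [mul_zero] at h5
    refine h5.congr fun s => ?_
    rw [h3, ← mul_assoc, ENNReal.inv_mul_cancel hA0 hAt, one_mul]
  -- Since `f` is real, taking real parts can only shrink the error.
  refine tendsto_of_tendsto_of_tendsto_of_le_of_le tendsto_const_nhds h4 (fun _ => zero_le)
    fun s => eLpNorm_mono fun x => ?_
  rw [h2]
  simpa using Complex.abs_re_le_norm (S s (toTorus L₁ L₂ x) - f x)

lemma phase_add_period {L₁ L₂ : ℝ} (hL₁ : 0 < L₁) (hL₂ : 0 < L₂) (k : Fin 3 → ℤ) (i : Fin 3)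
    (x : Fin 3 → ℝ) : phase L₁ L₂ k (x + Pi.single i ((![L₁, L₂, 2] : Fin 3 → ℝ) i)) =
      phase L₁ L₂ k x + k i * (2 * Real.pi) := by
  have hi := (side_pos hL₁ hL₂ i).ne'
  change phase L₁ L₂ k (x + Pi.single i (side L₁ L₂ i)) = _
  simp only [phase, Pi.add_apply, mul_add, Finset.sum_add_distrib]
  congr 1
  rw [Finset.sum_eq_single i (fun j _ hj => by simp [Pi.single_eq_of_ne hj]) (by simp),
    Pi.single_eq_same]
  field_simp

lemma hasFDerivAt_phase (L₁ L₂ : ℝ) (k : Fin 3 → ℤ) (x : Fin 3 → ℝ) :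
    ∃ A : (Fin 3 → ℝ) →L[ℝ] ℝ, HasFDerivAt (phase L₁ L₂ k) A x ∧
      ∀ i, A (Pi.single i 1) = 2 * Real.pi * k i / side L₁ L₂ i := by
  refine ⟨∑ i, (2 * Real.pi * k i / side L₁ L₂ i) • ContinuousLinearMap.proj i, ?_, fun i => ?_⟩
  · unfold phase
    exact HasFDerivAt.fun_sum fun i _ => (hasFDerivAt_apply i x).const_mul _
  · simp [Pi.single_apply]

lemma isPeriodicTest_cos {L₁ L₂ : ℝ} (hL₁ : 0 < L₁) (hL₂ : 0 < L₂) (k : Fin 3 → ℤ) :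
    IsPeriodicTest L₁ L₂ fun x => Real.cos (phase L₁ L₂ k x) :=
  ⟨Real.contDiff_cos.comp (contDiff_phase L₁ L₂ k), fun i x => by
    simp only [phase_add_period hL₁ hL₂, Real.cos_add_int_mul_two_pi]⟩

lemma isPeriodicTest_sin {L₁ L₂ : ℝ} (hL₁ : 0 < L₁) (hL₂ : 0 < L₂) (k : Fin 3 → ℤ) :
    IsPeriodicTest L₁ L₂ fun x => Real.sin (phase L₁ L₂ k x) :=
  ⟨Real.contDiff_sin.comp (contDiff_phase L₁ L₂ k), fun i x => by
    simp only [phase_add_period hL₁ hL₂, Real.sin_add_int_mul_two_pi]⟩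

lemma IsPeriodicTest.mul {L₁ L₂ : ℝ} {φ ψ : (Fin 3 → ℝ) → ℝ} (hφ : IsPeriodicTest L₁ L₂ φ)
    (hψ : IsPeriodicTest L₁ L₂ ψ) : IsPeriodicTest L₁ L₂ fun x => φ x * ψ x :=
  ⟨hφ.1.mul hψ.1, fun i x => by simp only [hφ.2 i x, hψ.2 i x]⟩

lemma isPeriodicTest_fourierSum {L₁ L₂ : ℝ} (hL₁ : 0 < L₁) (hL₂ : 0 < L₂)
    (s : Finset (Fin 3 → ℤ)) (f : LTwo L₁ L₂) : IsPeriodicTest L₁ L₂ (fourierSum s f) := by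
  constructor
  · unfold fourierSum
    exact ContDiff.sum fun k _ => contDiff_const.mul
      ((contDiff_const.mul (isPeriodicTest_cos hL₁ hL₂ k).1).add
        (contDiff_const.mul (isPeriodicTest_sin hL₁ hL₂ k).1))
  · intro i x
    simp only [fourierSum]
    refine Finset.sum_congr rfl fun k _ => ?_
    rw [phase_add_period hL₁ hL₂, Real.cos_add_int_mul_two_pi, Real.sin_add_int_mul_two_pi]

lemma fderiv_cos_phase (L₁ L₂ : ℝ) (k : Fin 3 → ℤ) (i : Fin 3) (x : Fin 3 → ℝ) :
    fderiv ℝ (fun x => Real.cos (phase L₁ L₂ k x)) x (Pi.single i 1) =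
      -(2 * Real.pi * k i / side L₁ L₂ i) * Real.sin (phase L₁ L₂ k x) := by
  obtain ⟨A, hA, hAi⟩ := hasFDerivAt_phase L₁ L₂ k x
  rw [hA.cos.fderiv]
  simp [hAi]; ring

lemma fderiv_sin_phase (L₁ L₂ : ℝ) (k : Fin 3 → ℤ) (i : Fin 3) (x : Fin 3 → ℝ) :
    fderiv ℝ (fun x => Real.sin (phase L₁ L₂ k x)) x (Pi.single i 1) =
      (2 * Real.pi * k i / side L₁ L₂ i) * Real.cos (phase L₁ L₂ k x) := by
  obtain ⟨A, hA, hAi⟩ := hasFDerivAt_phase L₁ L₂ k x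
  rw [hA.sin.fderiv]
  simp [hAi]; ring

/-- Fourier partial sums commute with weak derivatives. -/
lemma fderiv_fourierSum {L₁ L₂ : ℝ} (hL₁ : 0 < L₁) (hL₂ : 0 < L₂) {i : Fin 3}
    {f g : LTwo L₁ L₂} (h : IsWeakDeriv i f g) (s : Finset (Fin 3 → ℤ)) (x : Fin 3 → ℝ) :
    fderiv ℝ (fourierSum s f) x (Pi.single i 1) = fourierSum s g x := by
  choose A hA hAi using fun k => hasFDerivAt_phase L₁ L₂ k x
  have hd : HasFDerivAt (fourierSum s f) _ x := HasFDerivAt.fun_sum fun k _ =>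
    (((hA k).cos.const_mul (∫ y, f y * Real.cos (phase L₁ L₂ k y) ∂cellMeasure L₁ L₂)).add
      ((hA k).sin.const_mul (∫ y, f y * Real.sin (phase L₁ L₂ k y) ∂cellMeasure L₁ L₂))).const_mul
      (cellVol L₁ L₂)⁻¹
  rw [hd.fderiv, sum_apply, fourierSum]
  refine Finset.sum_congr rfl fun k _ => ?_
  have h1 := h _ (isPeriodicTest_cos hL₁ hL₂ k)
  have h2 := h _ (isPeriodicTest_sin hL₁ hL₂ k)
  simp only [fderiv_cos_phase, fderiv_sin_phase, mul_left_comm (_ : ℝ) (2 * Real.pi * _ / _) _,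
    mul_left_comm (_ : ℝ) (-(2 * Real.pi * _ / _)) _, integral_const_mul] at h1 h2
  -- Testing with the cosine expresses the cosine coefficient of `g` through the sine coefficient of
  -- `f`, and testing with the sine does the reverse; these are the coefficients that termwise
  -- differentiation produces.
  rw [← neg_eq_iff_eq_neg] at h1 h2
  rw [← h1, ← h2]
  simp only [add_apply, smul_apply, smul_eq_mul, hAi]
  ring

/-! ### A Loomis–Whitney inequality on the cell -/

lemma lintegral_rpow_half_mul_le {α : Type*} [MeasurableSpace α] (μ : Measure α)
    {g h : α → ENNReal} (hg : AEMeasurable g μ) (hh : AEMeasurable h μ) :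
    ∫⁻ x, g x ^ (1 / 2 : ℝ) * h x ^ (1 / 2 : ℝ) ∂μ ≤
      (∫⁻ x, g x ∂μ) ^ (1 / 2 : ℝ) * (∫⁻ x, h x ∂μ) ^ (1 / 2 : ℝ) := by
  have := ENNReal.lintegral_mul_le_Lp_mul_Lq μ Real.HolderConjugate.two_two
    (hg.pow_const (1 / 2 : ℝ)) (hh.pow_const (1 / 2 : ℝ))
  simpa only [Pi.mul_apply, ← ENNReal.rpow_mul, one_div, inv_mul_cancel₀ (two_ne_zero' ℝ),
    ENNReal.rpow_one] using this

section LoomisWhitney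

variable (m : Fin 3 → Measure ℝ)

/-- One stage of Loomis–Whitney: the factor independent of the coordinate `i` leaves the integral,
and Cauchy–Schwarz splits the other two. -/
lemma lmarginal_singleton_rpow_half_le (i : Fin 3) {f g h : (Fin 3 → ℝ) → ENNReal}
    (hf : ∀ x s, f (Function.update x i s) = f x) (hg : Measurable g) (hh : Measurable h)
    (x : Fin 3 → ℝ) :
    (∫⋯∫⁻_{i}, (fun y => f y ^ (1 / 2 : ℝ) * (g y ^ (1 / 2 : ℝ) * h y ^ (1 / 2 : ℝ))) ∂m) x ≤
      f x ^ (1 / 2 : ℝ) * ((∫⋯∫⁻_{i}, g ∂m) x ^ (1 / 2 : ℝ) *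
        (∫⋯∫⁻_{i}, h ∂m) x ^ (1 / 2 : ℝ)) := by
  simp only [lmarginal_singleton, hf]
  have hu : Measurable fun s => Function.update x i s := measurable_update x
  have hgh : Measurable fun s => g (Function.update x i s) ^ (1 / 2 : ℝ) *
      h (Function.update x i s) ^ (1 / 2 : ℝ) :=
    ((hg.comp hu).pow_const _).mul ((hh.comp hu).pow_const _)
  rw [lintegral_const_mul _ hgh]
  gcongr
  exact lintegral_rpow_half_mul_le _ (hg.comp hu).aemeasurable (hh.comp hu).aemeasurable

variable [∀ i, SigmaFinite (m i)]

lemma lintegral_pi_eq_lmarginal {F : (Fin 3 → ℝ) → ENNReal} (hF : Measurable F)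
    {i j k : Fin 3} (hij : i ≠ j) (hik : i ≠ k) (hjk : j ≠ k) (x : Fin 3 → ℝ) :
    (∫⋯∫⁻_{i}, ∫⋯∫⁻_{j}, ∫⋯∫⁻_{k}, F ∂m ∂m ∂m) x = ∫⁻ y, F y ∂Measure.pi m := by
  have hu : (Finset.univ : Finset (Fin 3)) = {i} ∪ ({j} ∪ {k}) := by
    revert i j k; decide
  have h := congrFun (lmarginal_univ (μ := m) (f := F)) x
  rw [← h, hu, lmarginal_union _ _ hF, lmarginal_union _ _ hF]
  · simpa using hjk
  · simp [hij, hik]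

/-- The Loomis–Whitney inequality in three dimensions. -/
lemma lintegral_lmarginal_rpow_half_le {F₀ F₁ F₂ : (Fin 3 → ℝ) → ENNReal} (h₀ : Measurable F₀)
    (h₁ : Measurable F₁) (h₂ : Measurable F₂) :
    ∫⁻ x, (∫⋯∫⁻_{0}, F₀ ∂m) x ^ (1 / 2 : ℝ) * ((∫⋯∫⁻_{1}, F₁ ∂m) x ^ (1 / 2 : ℝ) *
        (∫⋯∫⁻_{2}, F₂ ∂m) x ^ (1 / 2 : ℝ)) ∂Measure.pi m ≤
      (∫⁻ x, F₀ x ∂Measure.pi m) ^ (1 / 2 : ℝ) * ((∫⁻ x, F₁ x ∂Measure.pi m) ^ (1 / 2 : ℝ) *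
        (∫⁻ x, F₂ x ∂Measure.pi m) ^ (1 / 2 : ℝ)) := by
  set A := ∫⋯∫⁻_{0}, F₀ ∂m with hA
  set B := ∫⋯∫⁻_{1}, F₁ ∂m with hB
  set C := ∫⋯∫⁻_{2}, F₂ ∂m with hC
  have mA : Measurable A := h₀.lmarginal m
  have mB : Measurable B := h₁.lmarginal m
  have mC : Measurable C := h₂.lmarginal m
  have iA : ∀ x s, A (Function.update x 0 s) = A x := fun x s =>
    lmarginal_update_of_mem m (by simp) _ _ _
  -- Once integrated over coordinate 0, this factor is a marginal over both 0 and 1, hence constant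
  -- in coordinate 1 and ready to be pulled out at the second stage.
  have cB : ∫⋯∫⁻_{0}, B ∂m = ∫⋯∫⁻_{0} ∪ {1}, F₁ ∂m := (lmarginal_union m F₁ h₁ (by simp)).symm
  have iB : ∀ x s, (∫⋯∫⁻_{0}, B ∂m) (Function.update x 1 s) = (∫⋯∫⁻_{0}, B ∂m) x := fun x s => by
    rw [cB]; exact lmarginal_update_of_mem m (by simp) _ _ _
  have kA : ∀ x, (∫⋯∫⁻_{2}, ∫⋯∫⁻_{1}, A ∂m ∂m) x = ∫⁻ y, F₀ y ∂Measure.pi m := fun x =>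
    lintegral_pi_eq_lmarginal m h₀ (by decide) (by decide) (by decide) x
  have kB : ∀ x, (∫⋯∫⁻_{2}, ∫⋯∫⁻_{0}, B ∂m ∂m) x = ∫⁻ y, F₁ y ∂Measure.pi m := fun x =>
    lintegral_pi_eq_lmarginal m h₁ (by decide) (by decide) (by decide) x
  have kC : ∀ x, (∫⋯∫⁻_{1}, ∫⋯∫⁻_{0}, C ∂m ∂m) x = ∫⁻ y, F₂ y ∂Measure.pi m := fun x =>
    lintegral_pi_eq_lmarginal m h₂ (by decide) (by decide) (by decide) x
  have mAll : Measurable fun x => A x ^ (1 / 2 : ℝ) * (B x ^ (1 / 2 : ℝ) * C x ^ (1 / 2 : ℝ)) :=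
    (mA.pow_const _).mul ((mB.pow_const _).mul (mC.pow_const _))
  rw [← lintegral_pi_eq_lmarginal m mAll (i := 2) (j := 1) (k := 0) (by decide) (by decide)
    (by decide) 0]
  -- Integration runs over coordinates 0, 1, 2 in this order. `A` is pulled out first, then the
  -- marginal of `B`; after two stages `C` has become a full integral, which is the constant of the
  -- third.
  calc (∫⋯∫⁻_{2}, ∫⋯∫⁻_{1}, ∫⋯∫⁻_{0}, (fun x => A x ^ (1 / 2 : ℝ) * (B x ^ (1 / 2 : ℝ) *
        C x ^ (1 / 2 : ℝ))) ∂m ∂m ∂m) 0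
      ≤ (∫⋯∫⁻_{2}, ∫⋯∫⁻_{1}, (fun x => (∫⋯∫⁻_{0}, B ∂m) x ^ (1 / 2 : ℝ) * (A x ^ (1 / 2 : ℝ) *
        (∫⋯∫⁻_{0}, C ∂m) x ^ (1 / 2 : ℝ))) ∂m ∂m) 0 := by
        refine lmarginal_mono (lmarginal_mono fun x => ?_) 0
        refine (lmarginal_singleton_rpow_half_le m 0 iA mB mC x).trans_eq ?_
        ring
    _ ≤ (∫⋯∫⁻_{2}, (fun x => (∫⁻ x, F₂ x ∂Measure.pi m) ^ (1 / 2 : ℝ) *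
        ((∫⋯∫⁻_{1}, A ∂m) x ^ (1 / 2 : ℝ) * (∫⋯∫⁻_{0}, B ∂m) x ^ (1 / 2 : ℝ))) ∂m) 0 := by
        refine lmarginal_mono (fun x => ?_) 0
        refine (lmarginal_singleton_rpow_half_le m 1 iB mA (mC.lmarginal m) x).trans_eq ?_
        rw [kC]; ring
    _ ≤ _ := by
        refine (lmarginal_singleton_rpow_half_le m 2 (f := fun _ => ∫⁻ x, F₂ x ∂Measure.pi m)
          (fun _ _ => rfl) (mA.lmarginal m) (mB.lmarginal m) 0).trans_eq ?_
        rw [kA, kB]; ring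

end LoomisWhitney

/-! ### One-dimensional bounds along the edges -/

lemma enorm_sub_le_lintegral_deriv {φ φ' : ℝ → ℝ} (hφ : ∀ x, HasDerivAt φ (φ' x) x)
    (hφ' : Continuous φ') {a b r s : ℝ} (hr : r ∈ Ioo a b) (hs : s ∈ Ioo a b) :
    ‖φ s - φ r‖ₑ ≤ ∫⁻ x in Ioo a b, ‖φ' x‖ₑ := by
  rw [← intervalIntegral.integral_eq_sub_of_hasDerivAt (fun x _ => hφ x)
    (hφ'.intervalIntegrable _ _)]
  have h1 : ‖∫ x in r..s, φ' x‖ₑ = ‖∫ x in uIoc r s, φ' x‖ₑ := by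
    rw [← ofReal_norm, ← ofReal_norm, intervalIntegral.norm_integral_eq_norm_integral_uIoc]
  rw [h1]
  refine (enorm_integral_le_lintegral_enorm _).trans (lintegral_mono_set ?_)
  intro x hx
  rw [uIoc, mem_Ioc] at hx
  exact ⟨(lt_min hr.1 hs.1).trans hx.1, hx.2.trans_lt (max_lt hr.2 hs.2)⟩

/-- Integrate (φ²)' from r to s and average over r in the interval: the mean of φ² accounts for ℓ⁻¹,
the derivative 2φφ' for the 2. No boundary condition is needed. -/
lemma enorm_sq_le_lintegral {φ φ' : ℝ → ℝ} (hφ : ∀ x, HasDerivAt φ (φ' x) x)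
    (hφ' : Continuous φ') {a ℓ s : ℝ} (hℓ : 0 < ℓ) (hs : s ∈ Ioo a (a + ℓ)) :
    ‖φ s‖ₑ ^ 2 ≤ ENNReal.ofReal (ℓ⁻¹ + 2) *
      ∫⁻ x in Ioo a (a + ℓ), ‖φ x‖ₑ * (‖φ x‖ₑ + ‖φ' x‖ₑ) := by
  have hφc : Continuous φ := continuous_iff_continuousAt.2 fun x => (hφ x).continuousAt
  have m1 : Measurable fun x => ‖φ x‖ₑ := hφc.measurable.enorm
  have m2 : Measurable fun x => ‖φ' x‖ₑ := hφ'.measurable.enorm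
  set D := ∫⁻ x in Ioo a (a + ℓ), ‖φ x‖ₑ * ‖φ' x‖ₑ with hD
  have hsq : ∀ r ∈ Ioo a (a + ℓ), ‖φ s‖ₑ ^ 2 ≤ ‖φ r‖ₑ ^ 2 + 2 * D := by
    intro r hr
    have h := enorm_sub_le_lintegral_deriv (φ := fun x => φ x ^ 2) (φ' := fun x => 2 * (φ x * φ' x))
      (fun x => by simpa [mul_assoc] using (hφ x).fun_pow 2) (by fun_prop) hr hs
    have m12 : Measurable fun x => ‖φ x‖ₑ * ‖φ' x‖ₑ := m1.mul m2
    have h2 : ∫⁻ x in Ioo a (a + ℓ), ‖2 * (φ x * φ' x)‖ₑ = 2 * D := by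
      rw [hD, ← lintegral_const_mul _ m12]
      refine lintegral_congr fun x => ?_
      rw [enorm_mul, enorm_mul]
      congr 1
      simp [Real.enorm_eq_ofReal]
    rw [h2] at h
    calc ‖φ s‖ₑ ^ 2 = ‖φ r ^ 2 + (φ s ^ 2 - φ r ^ 2)‖ₑ := by rw [← enorm_pow]; ring_nf
      _ ≤ ‖φ r ^ 2‖ₑ + ‖φ s ^ 2 - φ r ^ 2‖ₑ := enorm_add_le _ _
      _ ≤ _ := by rw [enorm_pow]; gcongr
  have hint : ENNReal.ofReal ℓ * ‖φ s‖ₑ ^ 2 ≤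
      (∫⁻ x in Ioo a (a + ℓ), ‖φ x‖ₑ ^ 2) + ENNReal.ofReal ℓ * (2 * D) := by
    have := setLIntegral_mono (μ := volume) (s := Ioo a (a + ℓ)) (f := fun _ => ‖φ s‖ₑ ^ 2)
      (g := fun r => ‖φ r‖ₑ ^ 2 + 2 * D) (by fun_prop) hsq
    rw [lintegral_add_right _ measurable_const, setLIntegral_const, setLIntegral_const,
      Real.volume_Ioo, add_sub_cancel_left] at this
    rwa [mul_comm, mul_comm _ (2 * D)]
  have h0 : ENNReal.ofReal ℓ⁻¹ * ENNReal.ofReal ℓ = 1 := by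
    rw [← ENNReal.ofReal_mul (by positivity), inv_mul_cancel₀ hℓ.ne', ENNReal.ofReal_one]
  calc ‖φ s‖ₑ ^ 2 = ENNReal.ofReal ℓ⁻¹ * (ENNReal.ofReal ℓ * ‖φ s‖ₑ ^ 2) := by
        rw [← mul_assoc, h0, one_mul]
    _ ≤ ENNReal.ofReal ℓ⁻¹ * ((∫⁻ x in Ioo a (a + ℓ), ‖φ x‖ₑ ^ 2) +
        ENNReal.ofReal ℓ * (2 * D)) := by gcongr
    _ = ENNReal.ofReal ℓ⁻¹ * (∫⁻ x in Ioo a (a + ℓ), ‖φ x‖ₑ ^ 2) + 2 * D := by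
        rw [mul_add, ← mul_assoc, h0, one_mul]
    _ ≤ ENNReal.ofReal ℓ⁻¹ * (∫⁻ x in Ioo a (a + ℓ), ‖φ x‖ₑ * (‖φ x‖ₑ + ‖φ' x‖ₑ)) +
        2 * (∫⁻ x in Ioo a (a + ℓ), ‖φ x‖ₑ * (‖φ x‖ₑ + ‖φ' x‖ₑ)) := by
        gcongr
        · rw [sq]; gcongr; exact le_self_add
        · rw [hD]; gcongr; exact le_add_self
    _ = _ := by
        rw [ENNReal.ofReal_add (by positivity) (by norm_num), add_mul]
        simp

/-- The restriction of a `C¹` function to a line parallel to a coordinate axis. -/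
lemma hasDerivAt_update {f : (Fin 3 → ℝ) → ℝ} (hf : ContDiff ℝ 1 f) (x : Fin 3 → ℝ) (i : Fin 3)
    (s : ℝ) : HasDerivAt (fun r => f (Function.update x i r))
      (fderiv ℝ f (Function.update x i s) (Pi.single i 1)) s :=
  ((hf.differentiable (by simp)) _).hasFDerivAt.comp_hasDerivAt s (_root_.hasDerivAt_update x i s)

lemma continuous_fderiv_update {f : (Fin 3 → ℝ) → ℝ} (hf : ContDiff ℝ 1 f) (x : Fin 3 → ℝ)
    (i : Fin 3) :
    Continuous fun s => fderiv ℝ f (Function.update x i s) (Pi.single i 1) :=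
  ((hf.continuous_fderiv (by simp)).comp (continuous_const.update i continuous_id)).clm_apply
    continuous_const

/-- The integrand of the one-dimensional bound for `|f|²`. -/
def edgeEnergy (i : Fin 3) (f : (Fin 3 → ℝ) → ℝ) (x : Fin 3 → ℝ) : ENNReal :=
  ‖f x‖ₑ * (‖f x‖ₑ + ‖fderiv ℝ f x (Pi.single i 1)‖ₑ)

lemma measurable_edgeEnergy (i : Fin 3) {f : (Fin 3 → ℝ) → ℝ} (hf : ContDiff ℝ 1 f) :
    Measurable (edgeEnergy i f) := by
  have h2 : Continuous fun x => fderiv ℝ f x (Pi.single i 1) :=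
    (hf.continuous_fderiv (by simp)).clm_apply continuous_const
  exact hf.continuous.measurable.enorm.mul
    (hf.continuous.measurable.enorm.add h2.measurable.enorm)

lemma enorm_sq_le_lmarginal {L₁ L₂ : ℝ} (hL₁ : 0 < L₁) (hL₂ : 0 < L₂) (i : Fin 3)
    {f : (Fin 3 → ℝ) → ℝ} (hf : ContDiff ℝ 1 f) {x : Fin 3 → ℝ} (hx : x ∈ cell L₁ L₂) :
    ‖f x‖ₑ ^ 2 ≤ ENNReal.ofReal ((side L₁ L₂ i)⁻¹ + 2) *
      (∫⋯∫⁻_{i}, edgeEnergy i f ∂edgeMeasure L₁ L₂) x := by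
  rw [cell_eq_pi] at hx
  have := enorm_sq_le_lintegral (fun s => hasDerivAt_update hf x i s)
    (continuous_fderiv_update hf x i) (side_pos hL₁ hL₂ i) (hx i (mem_univ i))
  rw [lmarginal_singleton]
  rw [Function.update_eq_self] at this
  exact this

/-! ### The trilinear estimate -/

/-- `f' = ∂ᵢ f` in the strong sense: as a limit in `L²(Ω)` of derivatives of `C¹` functions. -/
def IsStrongDeriv {L₁ L₂ : ℝ} (i : Fin 3) (f f' : LTwo L₁ L₂) : Prop :=
  ∃ φ : ℕ → (Fin 3 → ℝ) → ℝ, (∀ n, ContDiff ℝ 1 (φ n)) ∧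
    Tendsto (fun n => eLpNorm (fun x => φ n x - f x) 2 (cellMeasure L₁ L₂)) atTop (𝓝 0) ∧
    Tendsto (fun n => eLpNorm (fun x => fderiv ℝ (φ n) x (Pi.single i 1) - f' x) 2
      (cellMeasure L₁ L₂)) atTop (𝓝 0)

lemma lintegral_enorm_mul_le {α : Type*} [MeasurableSpace α] (μ : Measure α) {f g : α → ℝ}
    (hf : AEStronglyMeasurable f μ) (hg : AEStronglyMeasurable g μ) :
    ∫⁻ x, ‖f x‖ₑ * ‖g x‖ₑ ∂μ ≤ eLpNorm f 2 μ * eLpNorm g 2 μ := by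
  have h := eLpNorm_smul_le_mul_eLpNorm (p := 2) (q := 2) (r := 1) hg hf
  rw [eLpNorm_one_eq_lintegral_enorm] at h
  simpa [enorm_mul] using h

/-- `‖f‖ (‖f‖ + ‖f'‖)` in `L²(Ω)`. -/
def mixedNorm (L₁ L₂ : ℝ) (f f' : (Fin 3 → ℝ) → ℝ) : ENNReal :=
  eLpNorm f 2 (cellMeasure L₁ L₂) * (eLpNorm f 2 (cellMeasure L₁ L₂) +
    eLpNorm f' 2 (cellMeasure L₁ L₂))

lemma lintegral_edgeEnergy_le (L₁ L₂ : ℝ) (i : Fin 3) {f : (Fin 3 → ℝ) → ℝ}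
    (hf : ContDiff ℝ 1 f) : ∫⁻ x, edgeEnergy i f x ∂cellMeasure L₁ L₂ ≤
      mixedNorm L₁ L₂ f fun x => fderiv ℝ f x (Pi.single i 1) := by
  have h2 : Continuous fun x => fderiv ℝ f x (Pi.single i 1) :=
    (hf.continuous_fderiv (by simp)).clm_apply continuous_const
  have m1 : Measurable fun x => ‖f x‖ₑ * ‖f x‖ₑ :=
    hf.continuous.measurable.enorm.mul hf.continuous.measurable.enorm
  simp only [edgeEnergy, mixedNorm, mul_add]
  rw [lintegral_add_left m1]
  have hf' := hf.continuous.aestronglyMeasurable (μ := cellMeasure L₁ L₂)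
  exact add_le_add (lintegral_enorm_mul_le _ hf' hf')
    (lintegral_enorm_mul_le _ hf' h2.aestronglyMeasurable)

/-- The constant of the trilinear estimate. -/
def trilinearConst (L₁ L₂ : ℝ) : ℝ := ∏ i, ((side L₁ L₂ i)⁻¹ + 2)

lemma trilinearConst_nonneg {L₁ L₂ : ℝ} (hL₁ : 0 < L₁) (hL₂ : 0 < L₂) :
    0 ≤ trilinearConst L₁ L₂ :=
  Finset.prod_nonneg fun i _ => by have := side_pos hL₁ hL₂ i; positivity

/-- Each factor is bounded by the square root of its edge integral in its own direction (z for `a`,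
y for `g`, x for `f`), which makes the product a Loomis–Whitney integrand. -/
lemma lintegral_trilinear_le {L₁ L₂ : ℝ} (hL₁ : 0 < L₁) (hL₂ : 0 < L₂)
    {a g f : (Fin 3 → ℝ) → ℝ} (ha : ContDiff ℝ 1 a) (hg : ContDiff ℝ 1 g) (hf : ContDiff ℝ 1 f) :
    ∫⁻ x, ‖a x * g x * f x‖ₑ ∂cellMeasure L₁ L₂ ≤
      (ENNReal.ofReal (trilinearConst L₁ L₂) *
        (mixedNorm L₁ L₂ a (fun x => fderiv ℝ a x (Pi.single 2 1)) *
        mixedNorm L₁ L₂ g (fun x => fderiv ℝ g x (Pi.single 1 1)) *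
        mixedNorm L₁ L₂ f (fun x => fderiv ℝ f x (Pi.single 0 1)))) ^ (1 / 2 : ℝ) := by
  have hhalf : (0 : ℝ) ≤ 1 / 2 := by norm_num
  have hroot : ∀ (i : Fin 3) {u : (Fin 3 → ℝ) → ℝ}, ContDiff ℝ 1 u → ∀ x ∈ cell L₁ L₂,
      ‖u x‖ₑ ≤ ENNReal.ofReal ((side L₁ L₂ i)⁻¹ + 2) ^ (1 / 2 : ℝ) *
        (∫⋯∫⁻_{i}, edgeEnergy i u ∂edgeMeasure L₁ L₂) x ^ (1 / 2 : ℝ) := fun i u hu x hx => by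
    have h := ENNReal.rpow_le_rpow (enorm_sq_le_lmarginal hL₁ hL₂ i hu hx) hhalf
    rw [ENNReal.mul_rpow_of_nonneg _ _ hhalf, ← ENNReal.rpow_natCast, ← ENNReal.rpow_mul] at h
    simpa using h
  set c : Fin 3 → ENNReal := fun i => ENNReal.ofReal ((side L₁ L₂ i)⁻¹ + 2) ^ (1 / 2 : ℝ) with hc
  have hC : ENNReal.ofReal (trilinearConst L₁ L₂) ^ (1 / 2 : ℝ) = c 0 * c 1 * c 2 := by
    rw [trilinearConst, ENNReal.ofReal_prod_of_nonneg, Fin.prod_univ_three,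
      ENNReal.mul_rpow_of_nonneg _ _ hhalf, ENNReal.mul_rpow_of_nonneg _ _ hhalf]
    exact fun i _ => by have := side_pos hL₁ hL₂ i; positivity
  have hLW := lintegral_lmarginal_rpow_half_le (edgeMeasure L₁ L₂) (measurable_edgeEnergy 0 hf)
    (measurable_edgeEnergy 1 hg) (measurable_edgeEnergy 2 ha)
  rw [← cellMeasure_eq_pi] at hLW
  have hmeas : Measurable fun x =>
      (∫⋯∫⁻_{0}, edgeEnergy 0 f ∂edgeMeasure L₁ L₂) x ^ (1 / 2 : ℝ) *
      ((∫⋯∫⁻_{1}, edgeEnergy 1 g ∂edgeMeasure L₁ L₂) x ^ (1 / 2 : ℝ) *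
        (∫⋯∫⁻_{2}, edgeEnergy 2 a ∂edgeMeasure L₁ L₂) x ^ (1 / 2 : ℝ)) :=
    (((measurable_edgeEnergy 0 hf).lmarginal _).pow_const _).mul
      ((((measurable_edgeEnergy 1 hg).lmarginal _).pow_const _).mul
        (((measurable_edgeEnergy 2 ha).lmarginal _).pow_const _))
  calc ∫⁻ x, ‖a x * g x * f x‖ₑ ∂cellMeasure L₁ L₂
      ≤ ∫⁻ x, (c 0 * c 1 * c 2) *
        ((∫⋯∫⁻_{0}, edgeEnergy 0 f ∂edgeMeasure L₁ L₂) x ^ (1 / 2 : ℝ) *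
        ((∫⋯∫⁻_{1}, edgeEnergy 1 g ∂edgeMeasure L₁ L₂) x ^ (1 / 2 : ℝ) *
        (∫⋯∫⁻_{2}, edgeEnergy 2 a ∂edgeMeasure L₁ L₂) x ^ (1 / 2 : ℝ))) ∂cellMeasure L₁ L₂ := by
        refine lintegral_mono_ae ?_
        filter_upwards [ae_restrict_mem (measurableSet_cell L₁ L₂)] with x hx
        rw [enorm_mul, enorm_mul]
        refine (mul_le_mul' (mul_le_mul' (hroot 2 ha x hx) (hroot 1 hg x hx))
          (hroot 0 hf x hx)).trans_eq ?_
        simp only [hc]; ring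
    _ ≤ _ := by
        rw [lintegral_const_mul _ hmeas, ENNReal.mul_rpow_of_nonneg _ _ hhalf,
          ENNReal.mul_rpow_of_nonneg _ _ hhalf, ENNReal.mul_rpow_of_nonneg _ _ hhalf, hC]
        gcongr
        refine hLW.trans ?_
        rw [mul_comm, mul_comm (_ ^ _) (_ ^ _)]
        gcongr
        · exact lintegral_edgeEnergy_le L₁ L₂ 2 ha
        · exact lintegral_edgeEnergy_le L₁ L₂ 1 hg
        · exact lintegral_edgeEnergy_le L₁ L₂ 0 hf

lemma tendsto_eLpNorm_of_sub {α : Type*} [MeasurableSpace α] {μ : Measure α} {φ : ℕ → α → ℝ}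
    {f : α → ℝ} (hφ : ∀ n, AEStronglyMeasurable (φ n) μ) (hf : AEStronglyMeasurable f μ)
    (h : Tendsto (fun n => eLpNorm (fun x => φ n x - f x) 2 μ) atTop (𝓝 0)) :
    Tendsto (fun n => eLpNorm (φ n) 2 μ) atTop (𝓝 (eLpNorm f 2 μ)) := by
  have hu : Tendsto (fun n => eLpNorm f 2 μ + eLpNorm (fun x => φ n x - f x) 2 μ) atTop
      (𝓝 (eLpNorm f 2 μ)) := by simpa using tendsto_const_nhds.add h
  have hl : Tendsto (fun n => eLpNorm f 2 μ - eLpNorm (fun x => φ n x - f x) 2 μ) atTop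
      (𝓝 (eLpNorm f 2 μ)) := by
    simpa using ENNReal.Tendsto.sub (tendsto_const_nhds (x := eLpNorm f 2 μ)) h (by simp)
  refine tendsto_of_tendsto_of_tendsto_of_le_of_le hl hu (fun n => ?_) (fun n => ?_)
  · rw [tsub_le_iff_right]
    have := eLpNorm_sub_le (p := 2) (hφ n) ((hφ n).sub hf) (by norm_num)
    simpa [Pi.sub_def] using this
  · have := eLpNorm_add_le (p := 2) hf ((hφ n).sub hf) (by norm_num)
    refine le_trans (le_of_eq ?_) this
    congr 1; funext x; simp

lemma tendsto_mixedNorm {L₁ L₂ : ℝ} {i : Fin 3} {f f' : LTwo L₁ L₂}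
    {φ : ℕ → (Fin 3 → ℝ) → ℝ} (hφ : ∀ n, ContDiff ℝ 1 (φ n))
    (h1 : Tendsto (fun n => eLpNorm (fun x => φ n x - f x) 2 (cellMeasure L₁ L₂)) atTop (𝓝 0))
    (h2 : Tendsto (fun n => eLpNorm (fun x => fderiv ℝ (φ n) x (Pi.single i 1) - f' x) 2
      (cellMeasure L₁ L₂)) atTop (𝓝 0)) :
    Tendsto (fun n => mixedNorm L₁ L₂ (φ n) fun x => fderiv ℝ (φ n) x (Pi.single i 1)) atTop
      (𝓝 (mixedNorm L₁ L₂ f f')) := by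
  have t1 := tendsto_eLpNorm_of_sub (fun n => (hφ n).continuous.aestronglyMeasurable)
    (Lp.aestronglyMeasurable f) h1
  have t2 := tendsto_eLpNorm_of_sub (φ := fun n x => fderiv ℝ (φ n) x (Pi.single i 1))
    (fun n => (((hφ n).continuous_fderiv (by simp)).clm_apply
      continuous_const).aestronglyMeasurable) (Lp.aestronglyMeasurable f') h2
  have e1 := Lp.eLpNorm_ne_top f
  have e2 := Lp.eLpNorm_ne_top f'
  exact ENNReal.Tendsto.mul t1 (Or.inr (ENNReal.add_ne_top.2 ⟨e1, e2⟩)) (t1.add t2) (Or.inr e1)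

lemma mixedNorm_coe {L₁ L₂ : ℝ} (f f' : LTwo L₁ L₂) :
    mixedNorm L₁ L₂ f f' = ENNReal.ofReal (‖f‖ * (‖f‖ + ‖f'‖)) := by
  have h : ∀ g : LTwo L₁ L₂, eLpNorm g 2 (cellMeasure L₁ L₂) = ENNReal.ofReal ‖g‖ := fun g => by
    rw [Lp.norm_def, ENNReal.ofReal_toReal (Lp.eLpNorm_ne_top g)]
  rw [mixedNorm, h, h, ENNReal.ofReal_mul (norm_nonneg _),
    ENNReal.ofReal_add (norm_nonneg _) (norm_nonneg _)]

lemma exists_subseq_tendsto_ae {α : Type*} [MeasurableSpace α] {μ : Measure α} {φ : ℕ → α → ℝ}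
    {f : α → ℝ} (hφ : ∀ n, AEStronglyMeasurable (φ n) μ) (hf : AEStronglyMeasurable f μ)
    (h : Tendsto (fun n => eLpNorm (fun x => φ n x - f x) 2 μ) atTop (𝓝 0)) :
    ∃ ns : ℕ → ℕ, StrictMono ns ∧ ∀ᵐ x ∂μ, Tendsto (fun n => φ (ns n) x) atTop (𝓝 (f x)) :=
  (tendstoInMeasure_of_tendsto_eLpNorm (by norm_num) hφ hf h).exists_seq_tendsto_ae

/-- Along a common subsequence the three C¹ approximations converge almost everywhere, so Fatou's
lemma handles the left side, while the right side is continuous in the norms involved. -/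
lemma lintegral_trilinear_le_of_isStrongDeriv {L₁ L₂ : ℝ} (hL₁ : 0 < L₁) (hL₂ : 0 < L₂)
    {a a' g g' f f' : LTwo L₁ L₂} (ha : IsStrongDeriv 2 a a') (hg : IsStrongDeriv 1 g g')
    (hf : IsStrongDeriv 0 f f') :
    ∫⁻ x, ‖a x * g x * f x‖ₑ ∂cellMeasure L₁ L₂ ≤
      (ENNReal.ofReal (trilinearConst L₁ L₂) *
        (mixedNorm L₁ L₂ a a' * mixedNorm L₁ L₂ g g' * mixedNorm L₁ L₂ f f')) ^ (1 / 2 : ℝ) := by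
  obtain ⟨α, hα, hα1, hα2⟩ := ha
  obtain ⟨γ, hγ, hγ1, hγ2⟩ := hg
  obtain ⟨φ, hφ, hφ1, hφ2⟩ := hf
  have mα := fun n => (hα n).continuous.aestronglyMeasurable (μ := cellMeasure L₁ L₂)
  have mγ := fun n => (hγ n).continuous.aestronglyMeasurable (μ := cellMeasure L₁ L₂)
  have mφ := fun n => (hφ n).continuous.aestronglyMeasurable (μ := cellMeasure L₁ L₂)
  obtain ⟨n₁, hn₁, h₁⟩ := exists_subseq_tendsto_ae mα (Lp.aestronglyMeasurable a) hα1
  obtain ⟨n₂, hn₂, h₂⟩ := exists_subseq_tendsto_ae (fun n => mγ (n₁ n))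
    (Lp.aestronglyMeasurable g) (hγ1.comp hn₁.tendsto_atTop)
  obtain ⟨n₃, hn₃, h₃⟩ := exists_subseq_tendsto_ae (fun n => mφ (n₁ (n₂ n)))
    (Lp.aestronglyMeasurable f) (hφ1.comp (hn₁.comp hn₂).tendsto_atTop)
  set ns := fun n => n₁ (n₂ (n₃ n)) with hns
  have hnst : Tendsto ns atTop atTop := (hn₁.comp (hn₂.comp hn₃)).tendsto_atTop
  have hfin : ∀ u v : LTwo L₁ L₂, mixedNorm L₁ L₂ u v ≠ ⊤ := fun u v => by
    rw [mixedNorm_coe]; exact ENNReal.ofReal_ne_top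
  have hR : Tendsto (fun n => (ENNReal.ofReal (trilinearConst L₁ L₂) *
      (mixedNorm L₁ L₂ (α (ns n)) (fun x => fderiv ℝ (α (ns n)) x (Pi.single 2 1)) *
        mixedNorm L₁ L₂ (γ (ns n)) (fun x => fderiv ℝ (γ (ns n)) x (Pi.single 1 1)) *
        mixedNorm L₁ L₂ (φ (ns n)) (fun x => fderiv ℝ (φ (ns n)) x (Pi.single 0 1)))) ^ (1 / 2 : ℝ))
      atTop (𝓝 ((ENNReal.ofReal (trilinearConst L₁ L₂) *
        (mixedNorm L₁ L₂ a a' * mixedNorm L₁ L₂ g g' * mixedNorm L₁ L₂ f f')) ^ (1 / 2 : ℝ))) := by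
    refine (ENNReal.continuous_rpow_const.tendsto _).comp (ENNReal.Tendsto.const_mul ?_
      (Or.inr ENNReal.ofReal_ne_top))
    refine ENNReal.Tendsto.mul (ENNReal.Tendsto.mul ((tendsto_mixedNorm hα hα1 hα2).comp hnst)
      (Or.inr (hfin _ _)) ((tendsto_mixedNorm hγ hγ1 hγ2).comp hnst) (Or.inr (hfin _ _)))
      (Or.inr (hfin _ _)) ((tendsto_mixedNorm hφ hφ1 hφ2).comp hnst)
      (Or.inr (ENNReal.mul_ne_top (hfin _ _) (hfin _ _)))
  calc ∫⁻ x, ‖a x * g x * f x‖ₑ ∂cellMeasure L₁ L₂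
      = ∫⁻ x, liminf (fun n => ‖α (ns n) x * γ (ns n) x * φ (ns n) x‖ₑ) atTop
          ∂cellMeasure L₁ L₂ := by
        refine lintegral_congr_ae ?_
        filter_upwards [h₁, h₂, h₃] with x x₁ x₂ x₃
        have := ((x₁.comp (hn₂.comp hn₃).tendsto_atTop).mul
          (x₂.comp hn₃.tendsto_atTop)).mul x₃
        exact ((continuous_enorm.tendsto _).comp this).liminf_eq.symm
    _ ≤ liminf (fun n => ∫⁻ x, ‖α (ns n) x * γ (ns n) x * φ (ns n) x‖ₑ ∂cellMeasure L₁ L₂)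
          atTop := lintegral_liminf_le fun n =>
        (((hα _).continuous.mul (hγ _).continuous).mul (hφ _).continuous).measurable.enorm
    _ ≤ liminf _ atTop := liminf_le_liminf (Eventually.of_forall fun n =>
        lintegral_trilinear_le hL₁ hL₂ (hα (ns n)) (hγ (ns n)) (hφ (ns n)))
    _ = _ := hR.liminf_eq

/-- The anisotropic trilinear estimate. -/
theorem trilinear_estimate {L₁ L₂ : ℝ} (hL₁ : 0 < L₁) (hL₂ : 0 < L₂)
    {a a' g g' f f' : LTwo L₁ L₂} (ha : IsStrongDeriv 2 a a') (hg : IsStrongDeriv 1 g g')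
    (hf : IsStrongDeriv 0 f f') :
    Integrable (fun x => a x * g x * f x) (cellMeasure L₁ L₂) ∧
    (∫ x, a x * g x * f x ∂cellMeasure L₁ L₂) ^ 2 ≤ trilinearConst L₁ L₂ *
      ((‖a‖ * (‖a‖ + ‖a'‖)) * (‖g‖ * (‖g‖ + ‖g'‖)) * (‖f‖ * (‖f‖ + ‖f'‖))) := by
  have h := lintegral_trilinear_le_of_isStrongDeriv hL₁ hL₂ ha hg hf
  have hK := trilinearConst_nonneg hL₁ hL₂
  rw [mixedNorm_coe, mixedNorm_coe, mixedNorm_coe, ← ENNReal.ofReal_mul (by positivity),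
    ← ENNReal.ofReal_mul (by positivity), ← ENNReal.ofReal_mul hK,
    ENNReal.ofReal_rpow_of_nonneg (by positivity) (by norm_num)] at h
  refine ⟨⟨((Lp.aestronglyMeasurable a).mul (Lp.aestronglyMeasurable g)).mul
    (Lp.aestronglyMeasurable f), h.trans_lt ENNReal.ofReal_lt_top⟩, ?_⟩
  have h2 := (enorm_integral_le_lintegral_enorm (μ := cellMeasure L₁ L₂)
    (fun x => a x * g x * f x)).trans h
  rw [← ofReal_norm, ENNReal.ofReal_le_ofReal_iff (by positivity), ← Real.sqrt_eq_rpow,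
    Real.norm_eq_abs] at h2
  rw [← sq_abs, ← Real.sqrt_le_sqrt_iff (by positivity), Real.sqrt_sq (abs_nonneg _)]
  exact h2

/-! ### Weak derivatives in `L²(Ω)` -/

lemma memLp_of_continuous (L₁ L₂ : ℝ) {φ : (Fin 3 → ℝ) → ℝ} (hφ : Continuous φ) :
    MemLp φ 2 (cellMeasure L₁ L₂) := by
  obtain ⟨C, hC⟩ := (isCompact_univ_pi fun i : Fin 3 =>
    isCompact_Icc (a := corner i) (b := corner i + side L₁ L₂ i)).exists_bound_of_continuousOn
    hφ.continuousOn
  refine MemLp.of_bound hφ.aestronglyMeasurable C ?_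
  filter_upwards [ae_restrict_mem (measurableSet_cell L₁ L₂)] with x hx
  rw [cell_eq_pi] at hx
  exact hC x fun i hi => Ioo_subset_Icc_self (hx i hi)

lemma integrable_mul_of_continuous {L₁ L₂ : ℝ} (f : LTwo L₁ L₂) {φ : (Fin 3 → ℝ) → ℝ}
    (hφ : Continuous φ) : Integrable (fun x => f x * φ x) (cellMeasure L₁ L₂) :=
  (Lp.memLp f).integrable_mul (memLp_of_continuous L₁ L₂ hφ)

lemma IsPeriodicTest.continuous_fderiv {L₁ L₂ : ℝ} {φ : (Fin 3 → ℝ) → ℝ}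
    (hφ : IsPeriodicTest L₁ L₂ φ) (i : Fin 3) :
    Continuous fun x => fderiv ℝ φ x (Pi.single i 1) :=
  (hφ.1.continuous_fderiv (by simp)).clm_apply continuous_const

lemma integral_coe_sub_mul {L₁ L₂ : ℝ} (f g : LTwo L₁ L₂) {φ : (Fin 3 → ℝ) → ℝ}
    (hφ : Continuous φ) : ∫ x, (f - g : LTwo L₁ L₂) x * φ x ∂cellMeasure L₁ L₂ =
      (∫ x, f x * φ x ∂cellMeasure L₁ L₂) - ∫ x, g x * φ x ∂cellMeasure L₁ L₂ := by
  rw [← integral_sub (integrable_mul_of_continuous f hφ) (integrable_mul_of_continuous g hφ)]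
  refine integral_congr_ae ?_
  filter_upwards [Lp.coeFn_sub f g] with x hx
  rw [hx, Pi.sub_apply, sub_mul]

lemma integral_coe_smul_mul {L₁ L₂ : ℝ} (c : ℝ) (f : LTwo L₁ L₂) (φ : (Fin 3 → ℝ) → ℝ) :
    ∫ x, (c • f : LTwo L₁ L₂) x * φ x ∂cellMeasure L₁ L₂ =
      c * ∫ x, f x * φ x ∂cellMeasure L₁ L₂ := by
  rw [← integral_const_mul]
  refine integral_congr_ae ?_
  filter_upwards [Lp.coeFn_smul c f] with x hx
  rw [hx, Pi.smul_apply, smul_eq_mul, mul_assoc]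

lemma IsWeakDeriv.sub {L₁ L₂ : ℝ} {i : Fin 3} {f f' g g' : LTwo L₁ L₂} (hf : IsWeakDeriv i f f')
    (hg : IsWeakDeriv i g g') : IsWeakDeriv i (f - g) (f' - g') := fun φ hφ => by
  rw [integral_coe_sub_mul _ _ (hφ.continuous_fderiv i), integral_coe_sub_mul _ _ hφ.1.continuous,
    hf φ hφ, hg φ hφ]
  ring

lemma IsWeakDeriv.const_smul {L₁ L₂ : ℝ} {i : Fin 3} {f f' : LTwo L₁ L₂}
    (hf : IsWeakDeriv i f f') (c : ℝ) : IsWeakDeriv i (c • f) (c • f') := fun φ hφ => by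
  rw [integral_coe_smul_mul, integral_coe_smul_mul, hf φ hφ]
  ring

/-! ### Parity and the reflection in z -/

lemma IsEvenZ.sub {L₁ L₂ : ℝ} {f g : LTwo L₁ L₂} (hr : Measure.QuasiMeasurePreserving reflectZ
    (cellMeasure L₁ L₂) (cellMeasure L₁ L₂)) (hf : IsEvenZ f) (hg : IsEvenZ g) :
    IsEvenZ (f - g) := by
  -- Representatives of a difference agree only almost everywhere; `hr` carries this over to
  -- reflected points.
  filter_upwards [hf, hg, Lp.coeFn_sub f g, hr.ae (Lp.coeFn_sub f g)] with x h1 h2 h3 h4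
  rw [h3, h4, Pi.sub_apply, Pi.sub_apply, h1, h2]

lemma IsEvenZ.const_smul {L₁ L₂ : ℝ} {f : LTwo L₁ L₂} (hr : Measure.QuasiMeasurePreserving reflectZ
    (cellMeasure L₁ L₂) (cellMeasure L₁ L₂)) (hf : IsEvenZ f) (c : ℝ) : IsEvenZ (c • f) := by
  filter_upwards [hf, Lp.coeFn_smul c f, hr.ae (Lp.coeFn_smul c f)] with x h1 h3 h4
  rw [h3, h4, Pi.smul_apply, Pi.smul_apply, h1]

lemma IsOddZ.sub {L₁ L₂ : ℝ} {f g : LTwo L₁ L₂} (hr : Measure.QuasiMeasurePreserving reflectZ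
    (cellMeasure L₁ L₂) (cellMeasure L₁ L₂)) (hf : IsOddZ f) (hg : IsOddZ g) :
    IsOddZ (f - g) := by
  filter_upwards [hf, hg, Lp.coeFn_sub f g, hr.ae (Lp.coeFn_sub f g)] with x h1 h2 h3 h4
  rw [h3, h4, Pi.sub_apply, Pi.sub_apply, h1, h2]
  ring

lemma IsOddZ.const_smul {L₁ L₂ : ℝ} {f : LTwo L₁ L₂} (hr : Measure.QuasiMeasurePreserving reflectZ
    (cellMeasure L₁ L₂) (cellMeasure L₁ L₂)) (hf : IsOddZ f) (c : ℝ) : IsOddZ (c • f) := by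
  filter_upwards [hf, Lp.coeFn_smul c f, hr.ae (Lp.coeFn_smul c f)] with x h1 h3 h4
  rw [h3, h4, Pi.smul_apply, Pi.smul_apply, h1, smul_neg]

/-- The vertical edge is (-1, 1), symmetric about 0, so the reflection acts factorwise on the
product measure. -/
lemma measurePreserving_reflectZ (L₁ L₂ : ℝ) :
    MeasurePreserving reflectZ (cellMeasure L₁ L₂) (cellMeasure L₁ L₂) := by
  rw [cellMeasure_eq_pi]
  have h2 : MeasurePreserving (fun x : ℝ => -x) (edgeMeasure L₁ L₂ 2) (edgeMeasure L₁ L₂ 2) := by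
    have h := (Measure.measurePreserving_neg (volume : Measure ℝ)).restrict_preimage
      (s := Ioo (corner 2) (corner 2 + side L₁ L₂ 2)) measurableSet_Ioo
    have hs : (Neg.neg : ℝ → ℝ) ⁻¹' Ioo (corner 2) (corner 2 + side L₁ L₂ 2) =
        Ioo (corner 2) (corner 2 + side L₁ L₂ 2) := by
      ext x; simp only [corner, side, mem_preimage, mem_Ioo, Matrix.cons_val]
      constructor <;> rintro ⟨h1, h2⟩ <;> constructor <;> linarith
    rw [hs] at h
    exact h
  have h := measurePreserving_pi (edgeMeasure L₁ L₂) (edgeMeasure L₁ L₂)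
    (f := ![id, id, fun x => -x]) fun i => by
      fin_cases i
      · exact MeasurePreserving.id _
      · exact MeasurePreserving.id _
      · exact h2
  convert h using 1
  funext x i
  fin_cases i <;> simp [reflectZ, Function.update]

lemma quasiMeasurePreserving_reflectZ (L₁ L₂ : ℝ) :
    Measure.QuasiMeasurePreserving reflectZ (cellMeasure L₁ L₂) (cellMeasure L₁ L₂) :=
  (measurePreserving_reflectZ L₁ L₂).quasiMeasurePreserving

/-! ### Strong derivatives and Fourier truncation in L² -/

lemma IsStrongDeriv.sub {L₁ L₂ : ℝ} {i : Fin 3} {f f' g g' : LTwo L₁ L₂}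
    (hf : IsStrongDeriv i f f') (hg : IsStrongDeriv i g g') :
    IsStrongDeriv i (f - g) (f' - g') := by
  obtain ⟨φ, hφ, hφ1, hφ2⟩ := hf
  obtain ⟨ψ, hψ, hψ1, hψ2⟩ := hg
  have key : ∀ (u v : LTwo L₁ L₂) (α β : ℕ → (Fin 3 → ℝ) → ℝ),
      (∀ n, Continuous (α n)) → (∀ n, Continuous (β n)) →
      Tendsto (fun n => eLpNorm (fun x => α n x - u x) 2 (cellMeasure L₁ L₂)) atTop (𝓝 0) →
      Tendsto (fun n => eLpNorm (fun x => β n x - v x) 2 (cellMeasure L₁ L₂)) atTop (𝓝 0) →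
      Tendsto (fun n => eLpNorm (fun x => (α n x - β n x) - (u - v : LTwo L₁ L₂) x) 2
        (cellMeasure L₁ L₂)) atTop (𝓝 0) := by
    intro u v α β hα hβ h1 h2
    have h3 := h1.add h2
    rw [add_zero] at h3
    refine tendsto_of_tendsto_of_tendsto_of_le_of_le tendsto_const_nhds h3 (fun _ => zero_le)
      fun n => ?_
    refine le_trans (le_of_eq ?_) (eLpNorm_sub_le (p := 2)
      ((hα n).aestronglyMeasurable.sub (Lp.aestronglyMeasurable u))
      ((hβ n).aestronglyMeasurable.sub (Lp.aestronglyMeasurable v)) (by norm_num))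
    refine eLpNorm_congr_ae ?_
    filter_upwards [Lp.coeFn_sub u v] with x hx
    simp only [hx, Pi.sub_apply]
    ring
  refine ⟨fun n x => φ n x - ψ n x, fun n => (hφ n).sub (hψ n), key _ _ _ _
    (fun n => (hφ n).continuous) (fun n => (hψ n).continuous) hφ1 hψ1, ?_⟩
  have hd : ∀ n x, fderiv ℝ (fun x => φ n x - ψ n x) x (Pi.single i 1) =
      fderiv ℝ (φ n) x (Pi.single i 1) - fderiv ℝ (ψ n) x (Pi.single i 1) := fun n x => by
    rw [fderiv_fun_sub ((hφ n).differentiable (by simp) x) ((hψ n).differentiable (by simp) x)]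
    rfl
  simp only [hd]
  exact key _ _ _ _ (fun n => ((hφ n).continuous_fderiv (by simp)).clm_apply continuous_const)
    (fun n => ((hψ n).continuous_fderiv (by simp)).clm_apply continuous_const) hφ2 hψ2

/-- Weak derivatives are strong derivatives. -/
lemma IsWeakDeriv.isStrongDeriv {L₁ L₂ : ℝ} (hL₁ : 0 < L₁) (hL₂ : 0 < L₂) {i : Fin 3}
    {f f' : LTwo L₁ L₂} (h : IsWeakDeriv i f f') : IsStrongDeriv i f f' := by
  obtain ⟨s, hs⟩ := exists_seq_tendsto (atTop : Filter (Finset (Fin 3 → ℤ)))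
  refine ⟨fun n => fourierSum (s n) f, fun n =>
    (isPeriodicTest_fourierSum hL₁ hL₂ _ f).1.of_le (by simp),
    (tendsto_fourierSum hL₁ hL₂ f).comp hs, ?_⟩
  simp only [fderiv_fourierSum hL₁ hL₂ h]
  exact (tendsto_fourierSum hL₁ hL₂ f').comp hs

lemma continuous_fourierSum {L₁ L₂ : ℝ} (s : Finset (Fin 3 → ℤ)) (f : LTwo L₁ L₂) :
    Continuous (fourierSum s f) := by
  unfold fourierSum; fun_prop

/-- The partial Fourier sums as elements of `L²(Ω)`. -/
def fourierLp {L₁ L₂ : ℝ} (s : Finset (Fin 3 → ℤ)) (f : LTwo L₁ L₂) : LTwo L₁ L₂ :=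
  (memLp_of_continuous L₁ L₂ (continuous_fourierSum s f)).toLp

lemma coeFn_fourierLp {L₁ L₂ : ℝ} (s : Finset (Fin 3 → ℤ)) (f : LTwo L₁ L₂) :
    fourierLp s f =ᵐ[cellMeasure L₁ L₂] fourierSum s f := MemLp.coeFn_toLp _

lemma tendsto_fourierLp {L₁ L₂ : ℝ} (hL₁ : 0 < L₁) (hL₂ : 0 < L₂) (f : LTwo L₁ L₂) :
    Tendsto (fun s => fourierLp s f) atTop (𝓝 f) := by
  rw [Lp.tendsto_Lp_iff_tendsto_eLpNorm']
  refine (tendsto_fourierSum hL₁ hL₂ f).congr fun s => eLpNorm_congr_ae ?_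
  filter_upwards [coeFn_fourierLp s f] with x hx
  rw [Pi.sub_apply, hx]

lemma isStrongDeriv_fourierLp {L₁ L₂ : ℝ} (hL₁ : 0 < L₁) (hL₂ : 0 < L₂) {i : Fin 3}
    {f f' : LTwo L₁ L₂} (h : IsWeakDeriv i f f') (s : Finset (Fin 3 → ℤ)) :
    IsStrongDeriv i (fourierLp s f) (fourierLp s f') := by
  have h0 : ∀ u : LTwo L₁ L₂, eLpNorm (fun x => fourierSum s u x - fourierLp s u x) 2
      (cellMeasure L₁ L₂) = 0 := fun u => by
    rw [← eLpNorm_zero (μ := cellMeasure L₁ L₂) (p := 2) (ε := ℝ)]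
    refine eLpNorm_congr_ae ?_
    filter_upwards [coeFn_fourierLp s u] with x hx
    rw [hx, sub_self, Pi.zero_apply]
  refine ⟨fun _ => fourierSum s f, fun n =>
    (isPeriodicTest_fourierSum hL₁ hL₂ _ f).1.of_le (by simp), ?_, ?_⟩
  · simp [h0]
  · simp [fderiv_fourierSum hL₁ hL₂ h, h0]

lemma integral_mul_eq_inner {L₁ L₂ : ℝ} (f g : LTwo L₁ L₂) :
    ∫ x, f x * g x ∂cellMeasure L₁ L₂ = inner ℝ f g := by
  rw [L2.inner_def]
  refine integral_congr_ae (Eventually.of_forall fun x => ?_)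
  simp [mul_comm]

/-- Integration by parts for weak derivatives. -/
lemma IsWeakDeriv.inner_eq_neg {L₁ L₂ : ℝ} (hL₁ : 0 < L₁) (hL₂ : 0 < L₂) {i : Fin 3}
    {f f' g g' : LTwo L₁ L₂} (hf : IsWeakDeriv i f f') (hg : IsWeakDeriv i g g') :
    inner ℝ f g' = -inner ℝ f' g := by
  have h : ∀ s, inner ℝ f (fourierLp s g') = -inner ℝ f' (fourierLp s g) := fun s => by
    -- The partial sums of `g` are admissible test functions, and their derivatives are the partial
    -- sums of `g'`.
    have h1 := hf _ (isPeriodicTest_fourierSum hL₁ hL₂ s g)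
    simp only [fderiv_fourierSum hL₁ hL₂ hg] at h1
    rw [← integral_mul_eq_inner, ← integral_mul_eq_inner]
    refine Eq.trans (integral_congr_ae ?_) (h1.trans (congrArg Neg.neg (integral_congr_ae ?_)))
    · filter_upwards [coeFn_fourierLp s g'] with x hx
      rw [hx]
    · filter_upwards [coeFn_fourierLp s g] with x hx
      rw [hx]
  have t1 := (tendsto_const_nhds (x := f)).inner (𝕜 := ℝ) (tendsto_fourierLp hL₁ hL₂ g')
  have t2 := ((tendsto_const_nhds (x := f')).inner (𝕜 := ℝ) (tendsto_fourierLp hL₁ hL₂ g)).neg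
  exact tendsto_nhds_unique t1 (t2.congr fun s => (h s).symm)

/-! ### Cancellation of the transport terms -/

/-- In the trilinear bound a factor whose norm tends to 0 needs only a convergent norm of its
derivative; either `g` or `f` may play this part. -/
lemma tendsto_zero_of_trilinear {L₁ L₂ : ℝ} (hL₁ : 0 < L₁) (hL₂ : 0 < L₂) {ι : Type*}
    {l : Filter ι} {a a' : LTwo L₁ L₂} (ha : IsStrongDeriv 2 a a') {g g' f f' : ι → LTwo L₁ L₂}
    (hg : ∀ s, IsStrongDeriv 1 (g s) (g' s)) (hf : ∀ s, IsStrongDeriv 0 (f s) (f' s))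
    {γ γ' φ φ' : ℝ} (h1 : Tendsto (fun s => ‖g s‖) l (𝓝 γ))
    (h2 : Tendsto (fun s => ‖g' s‖) l (𝓝 γ')) (h3 : Tendsto (fun s => ‖f s‖) l (𝓝 φ))
    (h4 : Tendsto (fun s => ‖f' s‖) l (𝓝 φ')) (h0 : γ = 0 ∨ φ = 0) :
    Tendsto (fun s => ∫ x, a x * g s x * f s x ∂cellMeasure L₁ L₂) l (𝓝 0) := by
  have hb : Tendsto (fun s => trilinearConst L₁ L₂ * ((‖a‖ * (‖a‖ + ‖a'‖)) *
      (‖g s‖ * (‖g s‖ + ‖g' s‖)) * (‖f s‖ * (‖f s‖ + ‖f' s‖)))) l (𝓝 0) := by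
    have := (((h1.mul (h1.add h2)).const_mul (‖a‖ * (‖a‖ + ‖a'‖))).mul
      (h3.mul (h3.add h4))).const_mul (trilinearConst L₁ L₂)
    convert this using 2
    rcases h0 with h | h <;> simp [h]
  have hsq := squeeze_zero (fun s => sq_nonneg _)
    (fun s => (trilinear_estimate hL₁ hL₂ ha (hg s) (hf s)).2) hb
  have h5 := hsq.sqrt
  simp only [Real.sqrt_sq_eq_abs, Real.sqrt_zero] at h5
  exact (tendsto_zero_iff_abs_tendsto_zero _).2 h5

/-- Telescoping: a(g_s f_s - g₀f₀) = a(g_s - g₀)f_s + a g₀(f_s - f₀), both parts vanishing in the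
limit by the trilinear bound. The coefficient `a` stays fixed, so it is never approximated. -/
lemma tendsto_trilinear {L₁ L₂ : ℝ} (hL₁ : 0 < L₁) (hL₂ : 0 < L₂) {ι : Type*}
    {l : Filter ι} {a a' : LTwo L₁ L₂} (ha : IsStrongDeriv 2 a a') {g g' f f' : ι → LTwo L₁ L₂}
    {g₀ g₀' f₀ f₀' : LTwo L₁ L₂}
    (hg : ∀ s, IsStrongDeriv 1 (g s) (g' s)) (hf : ∀ s, IsStrongDeriv 0 (f s) (f' s))
    (hg₀ : IsStrongDeriv 1 g₀ g₀') (hf₀ : IsStrongDeriv 0 f₀ f₀')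
    (h1 : Tendsto g l (𝓝 g₀)) (h2 : Tendsto g' l (𝓝 g₀')) (h3 : Tendsto f l (𝓝 f₀))
    (h4 : Tendsto f' l (𝓝 f₀')) :
    Tendsto (fun s => ∫ x, a x * g s x * f s x ∂cellMeasure L₁ L₂) l
      (𝓝 (∫ x, a x * g₀ x * f₀ x ∂cellMeasure L₁ L₂)) := by
  have hz : ∀ {u : ι → LTwo L₁ L₂} {u₀}, Tendsto u l (𝓝 u₀) →
      Tendsto (fun s => ‖u s - u₀‖) l (𝓝 0) := fun h => tendsto_iff_norm_sub_tendsto_zero.1 h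
  have t1 := tendsto_zero_of_trilinear hL₁ hL₂ ha (fun s => (hg s).sub hg₀) hf (hz h1) (hz h2)
    h3.norm h4.norm (Or.inl rfl)
  have t2 := tendsto_zero_of_trilinear hL₁ hL₂ ha (fun _ => hg₀) (fun s => (hf s).sub hf₀)
    tendsto_const_nhds tendsto_const_nhds (hz h3) (hz h4) (Or.inr rfl)
  have t3 := (t1.add t2).add_const (∫ x, a x * g₀ x * f₀ x ∂cellMeasure L₁ L₂)
  rw [add_zero, zero_add] at t3
  refine t3.congr fun s => ?_
  have i1 := (trilinear_estimate hL₁ hL₂ ha ((hg s).sub hg₀) (hf s)).1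
  have i2 := (trilinear_estimate hL₁ hL₂ ha hg₀ ((hf s).sub hf₀)).1
  have i3 := (trilinear_estimate hL₁ hL₂ ha hg₀ hf₀).1
  rw [← integral_add i1 i2, ← integral_add (i1.fun_add i2) i3]
  refine integral_congr_ae ?_
  filter_upwards [Lp.coeFn_sub (g s) g₀, Lp.coeFn_sub (f s) f₀] with x hx1 hx2
  simp only [hx1, hx2, Pi.sub_apply]
  ring

/-- `∫ (w · ∇) f g + ∫ (w · ∇) g f = 0` for a divergence-free field `w` and `f, g ∈ H²`. -/
lemma integral_transport_add_eq_zero {L₁ L₂ : ℝ} (hL₁ : 0 < L₁) (hL₂ : 0 < L₂)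
    {w w' : Fin 3 → LTwo L₁ L₂} (hw : ∀ k, IsStrongDeriv 2 (w k) (w' k))
    (hdiv : ∀ φ, IsPeriodicTest L₁ L₂ φ →
      ∑ k, ∫ x, w k x * fderiv ℝ φ x (Pi.single k 1) ∂cellMeasure L₁ L₂ = 0)
    {f g : LTwo L₁ L₂} {f₁ g₁ : Fin 3 → LTwo L₁ L₂} {f₂ g₂ : Fin 3 → LTwo L₁ L₂}
    (hf₁ : ∀ k, IsWeakDeriv k f (f₁ k)) (hg₁ : ∀ k, IsWeakDeriv k g (g₁ k))
    (hf₂ : ∀ k, IsWeakDeriv 1 (f₁ k) (f₂ k)) (hg₂ : ∀ k, IsWeakDeriv 1 (g₁ k) (g₂ k)) :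
    ∑ k, (∫ x, w k x * f₁ k x * g x ∂cellMeasure L₁ L₂ +
      ∫ x, w k x * g₁ k x * f x ∂cellMeasure L₁ L₂) = 0 := by
  have hS : ∀ {i : Fin 3} {u u' : LTwo L₁ L₂}, IsWeakDeriv i u u' → IsStrongDeriv i u u' :=
    fun h => h.isStrongDeriv hL₁ hL₂
  have hJ : ∀ {i : Fin 3} {u u' : LTwo L₁ L₂}, IsWeakDeriv i u u' → ∀ s,
      IsStrongDeriv i (fourierLp s u) (fourierLp s u') :=
    fun h s => isStrongDeriv_fourierLp hL₁ hL₂ h s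
  have hT := fun u : LTwo L₁ L₂ => tendsto_fourierLp hL₁ hL₂ u
  have t : Tendsto (fun s => ∑ k,
      (∫ x, w k x * fourierLp s (f₁ k) x * fourierLp s g x ∂cellMeasure L₁ L₂ +
      ∫ x, w k x * fourierLp s (g₁ k) x * fourierLp s f x ∂cellMeasure L₁ L₂)) atTop
      (𝓝 (∑ k, (∫ x, w k x * f₁ k x * g x ∂cellMeasure L₁ L₂ +
        ∫ x, w k x * g₁ k x * f x ∂cellMeasure L₁ L₂))) := by
    refine tendsto_finsetSum _ fun k _ => Tendsto.add ?_ ?_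
    -- The field supplies the z-derivative, the gradient component its y-derivative (this is where
    -- H² enters), and the remaining factor its x-derivative.
    · exact tendsto_trilinear hL₁ hL₂ (hw k) (hJ (hf₂ k)) (hJ (hg₁ 0)) (hS (hf₂ k)) (hS (hg₁ 0))
        (hT _) (hT _) (hT _) (hT _)
    · exact tendsto_trilinear hL₁ hL₂ (hw k) (hJ (hg₂ k)) (hJ (hf₁ 0)) (hS (hg₂ k)) (hS (hf₁ 0))
        (hT _) (hT _) (hT _) (hT _)
  refine tendsto_nhds_unique t (tendsto_const_nhds.congr fun s => ?_)
  have hF := isPeriodicTest_fourierSum hL₁ hL₂ s f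
  have hG := isPeriodicTest_fourierSum hL₁ hL₂ s g
  -- For truncated functions the sum is, by the product rule, the field tested against the gradient
  -- of the product of two partial sums.
  rw [← hdiv _ (hF.mul hG)]
  refine Finset.sum_congr rfl fun k _ => ?_
  rw [← integral_add (trilinear_estimate hL₁ hL₂ (hw k) (hJ (hf₂ k) s) (hJ (hg₁ 0) s)).1
    (trilinear_estimate hL₁ hL₂ (hw k) (hJ (hg₂ k) s) (hJ (hf₁ 0) s)).1]
  refine integral_congr_ae ?_
  filter_upwards [coeFn_fourierLp s f, coeFn_fourierLp s g, coeFn_fourierLp s (f₁ k),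
    coeFn_fourierLp s (g₁ k)] with x h1 h2 h3 h4
  rw [fderiv_fun_mul (hF.1.differentiable (by simp) x) (hG.1.differentiable (by simp) x),
    h1, h2, h3, h4]
  simp only [add_apply, smul_apply, smul_eq_mul, fderiv_fourierSum hL₁ hL₂ (hf₁ k),
    fderiv_fourierSum hL₁ hL₂ (hg₁ k)]
  ring

/-! ### A Poincaré inequality for odd functions -/

lemma edgeMeasure_two_univ (L₁ L₂ : ℝ) : edgeMeasure L₁ L₂ 2 univ = 2 := by
  simp [edgeMeasure, corner, side]

/-- Integrate ∂_z ψ along the vertical segment between x and its reflection and apply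
Cauchy–Schwarz; the 2 is the length of the vertical edge. -/
lemma enorm_sub_reflectZ_sq_le {L₁ L₂ : ℝ} {ψ : (Fin 3 → ℝ) → ℝ} (hψ : ContDiff ℝ 1 ψ)
    {x : Fin 3 → ℝ} (hx : x ∈ cell L₁ L₂) :
    ‖ψ x - ψ (reflectZ x)‖ₑ ^ (2 : ℝ) ≤
      2 * (∫⋯∫⁻_{2}, (fun y => ‖fderiv ℝ ψ y (Pi.single 2 1)‖ₑ ^ (2 : ℝ))
        ∂edgeMeasure L₁ L₂) x := by
  rw [cell_eq_pi] at hx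
  have h2 := hx 2 (mem_univ 2)
  have h2' : -x 2 ∈ Ioo (corner 2) (corner 2 + side L₁ L₂ 2) := by
    simp only [corner, side, mem_Ioo, Matrix.cons_val] at h2 ⊢
    constructor <;> linarith [h2.1, h2.2]
  have hc := continuous_fderiv_update hψ x 2
  have h := enorm_sub_le_lintegral_deriv (fun s => hasDerivAt_update hψ x 2 s) hc h2' h2
  rw [Function.update_eq_self] at h
  have hCS := lintegral_rpow_half_mul_le (edgeMeasure L₁ L₂ 2)
    (g := fun s => ‖fderiv ℝ ψ (Function.update x 2 s) (Pi.single 2 1)‖ₑ ^ (2 : ℝ))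
    (h := fun _ => 1) (hc.measurable.enorm.pow_const _).aemeasurable aemeasurable_const
  simp only [← ENNReal.rpow_mul, mul_one_div_cancel (two_ne_zero' ℝ), ENNReal.rpow_one,
    ENNReal.one_rpow, mul_one, lintegral_const, edgeMeasure_two_univ, one_mul] at hCS
  rw [lmarginal_singleton]
  calc ‖ψ x - ψ (reflectZ x)‖ₑ ^ (2 : ℝ) ≤ _ :=
        ENNReal.rpow_le_rpow (h.trans hCS) (by norm_num)
    _ = _ := by
        rw [ENNReal.mul_rpow_of_nonneg _ _ (by norm_num), ← ENNReal.rpow_mul, ← ENNReal.rpow_mul,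
          one_div_mul_cancel (two_ne_zero' ℝ), ENNReal.rpow_one, ENNReal.rpow_one, mul_comm]

/-- The marginal no longer depends on z, so integrating it over z once more multiplies it by the
edge length 2. -/
lemma lintegral_lmarginal_two (L₁ L₂ : ℝ) {H : (Fin 3 → ℝ) → ENNReal} (hH : Measurable H) :
    ∫⁻ x, (∫⋯∫⁻_{2}, H ∂edgeMeasure L₁ L₂) x ∂cellMeasure L₁ L₂ =
      2 * ∫⁻ x, H x ∂cellMeasure L₁ L₂ := by
  have hid : ∫⋯∫⁻_{2}, ∫⋯∫⁻_{2}, H ∂edgeMeasure L₁ L₂ ∂edgeMeasure L₁ L₂ =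
      fun x => 2 * (∫⋯∫⁻_{2}, H ∂edgeMeasure L₁ L₂) x := by
    rw [lmarginal_singleton]
    funext x
    simp only [lmarginal_update_of_mem (edgeMeasure L₁ L₂) (Finset.mem_singleton_self (2 : Fin 3)),
      lintegral_const, edgeMeasure_two_univ, mul_comm]
  have hm : Measurable (∫⋯∫⁻_{2}, H ∂edgeMeasure L₁ L₂) := hH.lmarginal _
  rw [cellMeasure_eq_pi, ← lintegral_pi_eq_lmarginal _ hm (i := 0) (j := 1) (k := 2) (by decide)
    (by decide) (by decide) 0, hid, ← lintegral_pi_eq_lmarginal _ hH (i := 0) (j := 1) (k := 2)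
    (by decide) (by decide) (by decide) 0,
    ← lmarginal_union _ _ (hm.const_mul 2) (by decide), ← lmarginal_union _ _ hm (by decide)]
  exact lintegral_const_mul _ (hm.comp measurable_updateFinset)

lemma eLpNorm_sub_reflectZ_le (L₁ L₂ : ℝ) {ψ : (Fin 3 → ℝ) → ℝ} (hψ : ContDiff ℝ 1 ψ) :
    eLpNorm (fun x => ψ x - ψ (reflectZ x)) 2 (cellMeasure L₁ L₂) ≤
      2 * eLpNorm (fun x => fderiv ℝ ψ x (Pi.single 2 1)) 2 (cellMeasure L₁ L₂) := by
  have hm : Measurable fun x => ‖fderiv ℝ ψ x (Pi.single 2 1)‖ₑ ^ (2 : ℝ) :=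
    (((hψ.continuous_fderiv (by simp)).clm_apply continuous_const).measurable.enorm).pow_const _
  rw [eLpNorm_eq_lintegral_rpow_enorm_toReal (by norm_num) (by norm_num),
    eLpNorm_eq_lintegral_rpow_enorm_toReal (by norm_num) (by norm_num)]
  simp only [ENNReal.toReal_ofNat]
  have h : ∫⁻ x, ‖ψ x - ψ (reflectZ x)‖ₑ ^ (2 : ℝ) ∂cellMeasure L₁ L₂ ≤
      2 ^ (2 : ℝ) * ∫⁻ x, ‖fderiv ℝ ψ x (Pi.single 2 1)‖ₑ ^ (2 : ℝ) ∂cellMeasure L₁ L₂ := by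
    refine (lintegral_mono_ae ((ae_restrict_mem (measurableSet_cell L₁ L₂)).mono fun x hx =>
      enorm_sub_reflectZ_sq_le hψ hx)).trans_eq ?_
    have hm' : Measurable (∫⋯∫⁻_{2}, (fun y => ‖fderiv ℝ ψ y (Pi.single 2 1)‖ₑ ^ (2 : ℝ))
      ∂edgeMeasure L₁ L₂) := hm.lmarginal _
    rw [lintegral_const_mul _ hm', lintegral_lmarginal_two L₁ L₂ hm, ← mul_assoc]
    norm_num
  refine (ENNReal.rpow_le_rpow h (by norm_num : (0 : ℝ) ≤ 1 / 2)).trans_eq ?_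
  rw [ENNReal.mul_rpow_of_nonneg _ _ (by norm_num), ← ENNReal.rpow_mul,
    mul_one_div_cancel (two_ne_zero' ℝ), ENNReal.rpow_one]

/-- A function that is odd in `z` is controlled by its `z`-derivative. -/
lemma IsOddZ.norm_le {L₁ L₂ : ℝ} {a a' : LTwo L₁ L₂} (ha : IsOddZ a)
    (h : IsStrongDeriv 2 a a') : ‖a‖ ≤ ‖a'‖ := by
  obtain ⟨φ, hφ, h1, h2⟩ := h
  have t2 := tendsto_eLpNorm_of_sub (φ := fun n x => fderiv ℝ (φ n) x (Pi.single 2 1))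
    (fun n => (((hφ n).continuous_fderiv (by simp)).clm_apply
      continuous_const).aestronglyMeasurable) (Lp.aestronglyMeasurable a') h2
  have hr := measurePreserving_reflectZ L₁ L₂
  have hle : ∀ n, eLpNorm ((2 : ℝ) • ⇑a) 2 (cellMeasure L₁ L₂) ≤
      2 * eLpNorm (fun x => φ n x - a x) 2 (cellMeasure L₁ L₂) +
      2 * eLpNorm (fun x => fderiv ℝ (φ n) x (Pi.single 2 1)) 2 (cellMeasure L₁ L₂) := fun n => by
    set e : (Fin 3 → ℝ) → ℝ := fun x => φ n x - a x with he
    have me : AEStronglyMeasurable e (cellMeasure L₁ L₂) :=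
      (hφ n).continuous.aestronglyMeasurable.sub (Lp.aestronglyMeasurable a)
    have mr : AEStronglyMeasurable (e ∘ reflectZ) (cellMeasure L₁ L₂) :=
      me.comp_measurePreserving hr
    have md : AEStronglyMeasurable (fun x => φ n x - φ n (reflectZ x)) (cellMeasure L₁ L₂) :=
      (hφ n).continuous.aestronglyMeasurable.sub
        ((hφ n).continuous.aestronglyMeasurable.comp_measurePreserving hr)
    -- Oddness gives 2a = a - a∘r for the reflection r; replacing `a` by φₙ - e leaves a reflection
    -- difference of a C¹ function and two errors of equal norm.
    have heq : (2 : ℝ) • ⇑a =ᵐ[cellMeasure L₁ L₂]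
        (fun x => φ n x - φ n (reflectZ x)) - (e - e ∘ reflectZ) := by
      filter_upwards [ha] with x hx
      simp only [Pi.smul_apply, Pi.sub_apply, Function.comp_apply, he, hx, smul_eq_mul]
      ring
    rw [eLpNorm_congr_ae heq]
    refine (eLpNorm_sub_le md (me.sub mr) (by norm_num)).trans ?_
    rw [add_comm, two_mul (eLpNorm e _ _)]
    refine add_le_add ?_ (eLpNorm_sub_reflectZ_le L₁ L₂ (hφ n))
    refine (eLpNorm_sub_le me mr (by norm_num)).trans_eq ?_
    rw [eLpNorm_comp_measurePreserving me hr]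
  have tR : Tendsto (fun n => 2 * eLpNorm (fun x => φ n x - a x) 2 (cellMeasure L₁ L₂) +
      2 * eLpNorm (fun x => fderiv ℝ (φ n) x (Pi.single 2 1)) 2 (cellMeasure L₁ L₂)) atTop
      (𝓝 (2 * eLpNorm a' 2 (cellMeasure L₁ L₂))) := by
    have := (ENNReal.Tendsto.const_mul (a := 2) h1 (Or.inr (by norm_num))).add
      (ENNReal.Tendsto.const_mul (a := 2) t2 (Or.inr (by norm_num)))
    simpa using this
  have hfin := ge_of_tendsto' tR hle
  rw [eLpNorm_const_smul, show ‖(2 : ℝ)‖ₑ = 2 by simp [Real.enorm_eq_ofReal],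
    ENNReal.mul_le_mul_iff_right (by norm_num) (by norm_num)] at hfin
  rw [Lp.norm_def, Lp.norm_def]
  exact ENNReal.toReal_mono (Lp.eLpNorm_ne_top a') hfin

/-! ### An energy form of Grönwall's inequality -/

section Gronwall

lemma AbsolutelyContinuousOnInterval.of_dist_le {X Y : Type*} [PseudoMetricSpace X]
    [PseudoMetricSpace Y] {f : ℝ → X} {Γ : ℝ → Y} {a b C : ℝ} (hC : 0 ≤ C)
    (hΓ : AbsolutelyContinuousOnInterval Γ a b)
    (h : ∀ x ∈ uIcc a b, ∀ y ∈ uIcc a b, dist (f x) (f y) ≤ C * dist (Γ x) (Γ y)) :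
    AbsolutelyContinuousOnInterval f a b := by
  rw [absolutelyContinuousOnInterval_iff] at hΓ ⊢
  intro ε hε
  -- `C + 1` avoids a division by zero, as `C` may vanish.
  obtain ⟨δ, hδ, H⟩ := hΓ (ε / (C + 1)) (by positivity)
  refine ⟨δ, hδ, fun E hE hEδ => ?_⟩
  have h1 := H E hE hEδ
  have h2 : ∑ i ∈ Finset.range E.1, dist (f (E.2 i).1) (f (E.2 i).2) ≤
      C * ∑ i ∈ Finset.range E.1, dist (Γ (E.2 i).1) (Γ (E.2 i).2) := by
    rw [Finset.mul_sum]
    exact Finset.sum_le_sum fun i hi => h _ (hE.1 i hi).1 _ (hE.1 i hi).2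
  refine h2.trans_lt ?_
  have h3 : 0 ≤ ∑ i ∈ Finset.range E.1, dist (Γ (E.2 i).1) (Γ (E.2 i).2) :=
    Finset.sum_nonneg fun _ _ => dist_nonneg
  rw [lt_div_iff₀ (by positivity)] at h1
  nlinarith

lemma AbsolutelyContinuousOnInterval.finset_sum {ι : Type*} (s : Finset ι) {f : ι → ℝ → ℝ}
    {a b : ℝ} (h : ∀ i ∈ s, AbsolutelyContinuousOnInterval (f i) a b) :
    AbsolutelyContinuousOnInterval (fun t => ∑ i ∈ s, f i t) a b := by
  classical
  induction s using Finset.induction_on with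
  | empty =>
    simp only [Finset.sum_empty]
    exact (contDiff_const (c := (0 : ℝ))).contDiffOn.absolutelyContinuousOnInterval
  | insert i s hi ih =>
    simp only [Finset.sum_insert hi]
    exact (h i (Finset.mem_insert_self i s)).add
      (ih fun j hj => h j (Finset.mem_insert_of_mem hj))

lemma AbsolutelyContinuousOnInterval.exp {f : ℝ → ℝ} {a b : ℝ}
    (hf : AbsolutelyContinuousOnInterval f a b) :
    AbsolutelyContinuousOnInterval (fun t => Real.exp (f t)) a b := by
  obtain ⟨M, hM⟩ := hf.exists_bound
  refine AbsolutelyContinuousOnInterval.of_dist_le (Real.exp_pos M).le hf fun x hx y hy => ?_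
  rw [dist_eq_norm, dist_eq_norm]
  refine Convex.norm_image_sub_le_of_norm_deriv_le (s := Iic M)
    (fun x _ => Real.differentiableAt_exp) (fun z hz => ?_) (convex_Iic M)
    ((le_abs_self _).trans (hM y hy)) ((le_abs_self _).trans (hM x hx))
  rw [Real.deriv_exp, Real.norm_eq_abs, abs_of_pos (Real.exp_pos z)]
  exact Real.exp_le_exp.2 hz

variable {H : Type*} [NormedAddCommGroup H] [InnerProductSpace ℝ H]

/-- Increments of `v` are dominated by those of t ↦ ∫₀ᵗ ‖d‖, and ‖v‖ by its final value M; factoring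
the difference of squares costs 2M. -/
lemma absolutelyContinuousOnInterval_norm_sq {v d : ℝ → H} {T : ℝ} (hT : 0 ≤ T)
    (hd : IntervalIntegrable d volume 0 T) (hv : ∀ t ∈ Icc 0 T, v t = ∫ s in (0 : ℝ)..t, d s) :
    AbsolutelyContinuousOnInterval (fun t => ‖v t‖ ^ 2) 0 T := by
  have hΓ := hd.norm.absolutelyContinuousOnInterval_intervalIntegral (c := 0) (by simp)
  have hint : ∀ x ∈ Icc 0 T, ∀ y ∈ Icc 0 T, IntervalIntegrable d volume x y := fun x hx y hy =>
    hd.mono_set (by rw [uIcc_of_le hT]; exact uIcc_subset_Icc hx hy)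
  have h0 : (0 : ℝ) ∈ Icc 0 T := ⟨le_rfl, hT⟩
  have hdist : ∀ x ∈ Icc 0 T, ∀ y ∈ Icc 0 T, ‖v x - v y‖ ≤
      dist (∫ s in (0 : ℝ)..x, ‖d s‖) (∫ s in (0 : ℝ)..y, ‖d s‖) := by
    intro x hx y hy
    rw [hv x hx, hv y hy, intervalIntegral.integral_interval_sub_left (hint 0 h0 x hx)
      (hint 0 h0 y hy), Real.dist_eq, intervalIntegral.integral_interval_sub_left
      (hint 0 h0 x hx).norm (hint 0 h0 y hy).norm]
    exact intervalIntegral.norm_integral_le_abs_integral_norm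
  have hvb : ∀ x ∈ Icc 0 T, ‖v x‖ ≤ ∫ s in (0 : ℝ)..T, ‖d s‖ := by
    intro x hx
    rw [hv x hx]
    refine (intervalIntegral.norm_integral_le_integral_norm hx.1).trans ?_
    exact intervalIntegral.integral_mono_interval le_rfl hx.1 hx.2
      (Eventually.of_forall fun _ => norm_nonneg _) hd.norm
  set M := ∫ s in (0 : ℝ)..T, ‖d s‖
  have hM : 0 ≤ M := (norm_nonneg _).trans (hvb 0 h0)
  refine AbsolutelyContinuousOnInterval.of_dist_le (C := 2 * M) (by positivity) hΓ
    fun x hx y hy => ?_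
  rw [uIcc_of_le hT] at hx hy
  refine le_trans ?_ (mul_le_mul_of_nonneg_left (hdist x hx y hy) (by positivity))
  rw [Real.dist_eq, sq_sub_sq, abs_mul, abs_of_nonneg (by positivity : 0 ≤ ‖v x‖ + ‖v y‖)]
  exact mul_le_mul (by linarith [hvb x hx, hvb y hy]) (abs_norm_sub_norm_le _ _) (abs_nonneg _)
    (by positivity)

variable [CompleteSpace H]

/-- If `vᵢ` is a primitive of `dᵢ`, `vᵢ(0) = 0` and `∑ ⟨dᵢ, vᵢ⟩ ≤ g ∑ ‖vᵢ‖²` with an integrable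
`g`, then all `vᵢ` vanish. -/
theorem eq_zero_of_inner_le {ι : Type*} [Fintype ι] {v d : ι → ℝ → H} {g : ℝ → ℝ} {T : ℝ}
    (hT : 0 ≤ T) (hd : ∀ i, IntervalIntegrable (d i) volume 0 T)
    (hv : ∀ i, ∀ t ∈ Icc 0 T, v i t = ∫ s in (0 : ℝ)..t, d i s)
    (hg : IntervalIntegrable g volume 0 T)
    (hle : ∀ᵐ t ∂(volume.restrict (Ioo 0 T)),
      ∑ i, inner ℝ (d i t) (v i t) ≤ g t * ∑ i, ‖v i t‖ ^ 2) :
    ∀ i, ∀ t ∈ Icc 0 T, v i t = 0 := by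
  set E : ℝ → ℝ := fun t => ∑ i, ‖v i t‖ ^ 2 with hE
  set e : ℝ → ℝ := fun t => Real.exp ((-2) * ∫ s in (0 : ℝ)..t, g s) with he
  have acE : AbsolutelyContinuousOnInterval E 0 T :=
    AbsolutelyContinuousOnInterval.finset_sum _ fun i _ =>
      absolutelyContinuousOnInterval_norm_sq hT (hd i) (hv i)
  -- The integrating factor carries -2 because the derivative of ‖v‖² is twice an inner product. The
  -- exponential stays absolutely continuous since it is Lipschitz below any bound of its argument.
  have ace : AbsolutelyContinuousOnInterval e 0 T := AbsolutelyContinuousOnInterval.exp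
    ((hg.absolutelyContinuousOnInterval_intervalIntegral (c := 0) (by simp)).const_mul (-2))
  have hderiv : ∀ᵐ t ∂(volume.restrict (Ioo 0 T)), deriv (E * e) t ≤ 0 := by
    have hd' : ∀ᵐ t, ∀ i, t ∈ uIcc 0 T →
        ∀ c ∈ uIcc 0 T, HasDerivAt (fun x => ∫ s in c..x, d i s) (d i t) t :=
      ae_all_iff.2 fun i => (hd i).ae_hasDerivAt_integral
    filter_upwards [hle, ae_restrict_mem measurableSet_Ioo, ae_restrict_of_ae hd',
      ae_restrict_of_ae hg.ae_hasDerivAt_integral] with t h1 h2 h3 h4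
    have htm : t ∈ uIcc 0 T := by rw [uIcc_of_le hT]; exact Ioo_subset_Icc_self h2
    have hvd : ∀ i, HasDerivAt (v i) (d i t) t := fun i => by
      refine (h3 i htm 0 (by simp)).congr_of_eventuallyEq ?_
      filter_upwards [Icc_mem_nhds h2.1 h2.2] with s hs using hv i s hs
    have hEd : HasDerivAt E (∑ i, 2 * inner ℝ (v i t) (d i t)) t :=
      HasDerivAt.fun_sum fun i _ => (hvd i).norm_sq
    have hed : HasDerivAt e (e t * (-2 * g t)) t := ((h4 htm 0 (by simp)).const_mul (-2)).exp
    rw [(hEd.mul hed).deriv, ← Finset.mul_sum]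
    have hcomm : ∀ i, inner ℝ (v i t) (d i t) = inner ℝ (d i t) (v i t) :=
      fun i => real_inner_comm _ _
    simp only [hcomm]
    have hpos : 0 < e t := Real.exp_pos _
    have : E t = ∑ i, ‖v i t‖ ^ 2 := rfl
    rw [← this] at h1
    have h5 := mul_le_mul_of_nonneg_left h1 hpos.le
    nlinarith [h5]
  intro i t ht
  have acP : AbsolutelyContinuousOnInterval (E * e) 0 t :=
    (acE.mul ace).mono (by rw [uIcc_of_le hT, uIcc_of_le ht.1]; exact Icc_subset_Icc_right ht.2)
  -- Absolute continuity is what lets the almost everywhere sign of the derivative bound the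
  -- function.
  have hFTC := acP.integral_deriv_eq_sub
  have hE0 : E 0 = 0 := by
    simp only [hE]
    refine Finset.sum_eq_zero fun i _ => ?_
    rw [hv i 0 ⟨le_rfl, hT⟩]; simp
  have hneg : ∫ s in (0 : ℝ)..t, deriv (E * e) s ≤ 0 := by
    rw [intervalIntegral.integral_of_le ht.1, integral_Ioc_eq_integral_Ioo]
    refine integral_nonpos_of_ae ?_
    exact ae_restrict_of_ae_restrict_of_subset (Ioo_subset_Ioo_right ht.2) hderiv
  rw [hFTC] at hneg
  simp only [Pi.mul_apply, hE0, zero_mul, sub_zero] at hneg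
  have hpos : 0 < e t := Real.exp_pos _
  have hEt : E t ≤ 0 := nonpos_of_mul_nonpos_left hneg hpos
  have h6 : ‖v i t‖ ^ 2 ≤ E t :=
    Finset.single_le_sum (f := fun i => ‖v i t‖ ^ 2) (fun _ _ => sq_nonneg _) (Finset.mem_univ i)
  have h7 : ‖v i t‖ ^ 2 = 0 := le_antisymm (h6.trans hEt) (sq_nonneg _)
  simpa using h7

end Gronwall

/-! ### The energy inequality at a fixed time -/

/-- An element of the periodic space `H²` with its weak derivatives. -/
structure HTwo (L₁ L₂ : ℝ) where
  val : LTwo L₁ L₂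
  grad : Fin 3 → LTwo L₁ L₂
  hess : Fin 3 → Fin 3 → LTwo L₁ L₂
  isWeakDeriv_grad : ∀ k, IsWeakDeriv k val (grad k)
  isWeakDeriv_hess : ∀ j k, IsWeakDeriv k (grad j) (hess j k)

/-- The difference of two elements of `H²`. -/
def HTwo.sub {L₁ L₂ : ℝ} (f g : HTwo L₁ L₂) : HTwo L₁ L₂ where
  val := f.val - g.val
  grad k := f.grad k - g.grad k
  hess j k := f.hess j k - g.hess j k
  isWeakDeriv_grad k := (f.isWeakDeriv_grad k).sub (g.isWeakDeriv_grad k)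
  isWeakDeriv_hess j k := (f.isWeakDeriv_hess j k).sub (g.isWeakDeriv_hess j k)

lemma HTwo.inner_hess {L₁ L₂ : ℝ} (hL₁ : 0 < L₁) (hL₂ : 0 < L₂) (f : HTwo L₁ L₂) (k : Fin 3) :
    inner ℝ (f.hess k k) f.val = -‖f.grad k‖ ^ 2 := by
  rw [real_inner_comm, (f.isWeakDeriv_grad k).inner_eq_neg hL₁ hL₂ (f.isWeakDeriv_hess k k),
    real_inner_self_eq_norm_sq]

/-- `∫ a g f` over the cell. -/
def triple {L₁ L₂ : ℝ} (a g f : LTwo L₁ L₂) : ℝ := ∫ x, a x * g x * f x ∂cellMeasure L₁ L₂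

/-- `f` is integrable over the cell with integral `c`. -/
def IntegratesTo (L₁ L₂ : ℝ) (f : (Fin 3 → ℝ) → ℝ) (c : ℝ) : Prop :=
  Integrable f (cellMeasure L₁ L₂) ∧ ∫ x, f x ∂cellMeasure L₁ L₂ = c

namespace IntegratesTo

variable {L₁ L₂ : ℝ} {f g : (Fin 3 → ℝ) → ℝ} {c d : ℝ}

lemma add (hf : IntegratesTo L₁ L₂ f c) (hg : IntegratesTo L₁ L₂ g d) :
    IntegratesTo L₁ L₂ (fun x => f x + g x) (c + d) :=
  ⟨hf.1.add hg.1, by rw [integral_add hf.1 hg.1, hf.2, hg.2]⟩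

lemma sub (hf : IntegratesTo L₁ L₂ f c) (hg : IntegratesTo L₁ L₂ g d) :
    IntegratesTo L₁ L₂ (fun x => f x - g x) (c - d) :=
  ⟨hf.1.sub hg.1, by rw [integral_sub hf.1 hg.1, hf.2, hg.2]⟩

lemma const_mul (hf : IntegratesTo L₁ L₂ f c) (r : ℝ) :
    IntegratesTo L₁ L₂ (fun x => r * f x) (r * c) :=
  ⟨hf.1.const_mul r, by rw [integral_const_mul, hf.2]⟩

lemma sum {ι : Type*} [Fintype ι] {F : ι → (Fin 3 → ℝ) → ℝ} {C : ι → ℝ}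
    (h : ∀ i, IntegratesTo L₁ L₂ (F i) (C i)) :
    IntegratesTo L₁ L₂ (fun x => ∑ i, F i x) (∑ i, C i) :=
  ⟨integrable_finsetSum _ fun i _ => (h i).1, by
    rw [integral_finsetSum _ fun i _ => (h i).1]
    exact Finset.sum_congr rfl fun i _ => (h i).2⟩

lemma unique (hf : IntegratesTo L₁ L₂ f c) (hg : IntegratesTo L₁ L₂ g d)
    (h : f =ᵐ[cellMeasure L₁ L₂] g) : c = d := by
  rw [← hf.2, ← hg.2, integral_congr_ae h]

lemma inner (u v : LTwo L₁ L₂) : IntegratesTo L₁ L₂ (fun x => u x * v x) (inner ℝ u v) :=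
  ⟨(Lp.memLp u).integrable_mul (Lp.memLp v), integral_mul_eq_inner u v⟩

end IntegratesTo

/-- Pairing an evolution equation with its unknown. -/
lemma inner_eq_of_equation {L₁ L₂ μ ν : ℝ} (v : HTwo L₁ L₂) {d r q : LTwo L₁ L₂}
    {a₁ g₁ a₂ g₂ a₃ g₃ a₄ g₄ : Fin 3 → LTwo L₁ L₂}
    (h₁ : ∀ k, Integrable (fun x => a₁ k x * g₁ k x * v.val x) (cellMeasure L₁ L₂))
    (h₂ : ∀ k, Integrable (fun x => a₂ k x * g₂ k x * v.val x) (cellMeasure L₁ L₂))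
    (h₃ : ∀ k, Integrable (fun x => a₃ k x * g₃ k x * v.val x) (cellMeasure L₁ L₂))
    (h₄ : ∀ k, Integrable (fun x => a₄ k x * g₄ k x * v.val x) (cellMeasure L₁ L₂))
    (h : ∀ᵐ x ∂cellMeasure L₁ L₂, d x + ∑ k, a₁ k x * g₁ k x + ∑ k, a₂ k x * g₂ k x + q x
      - ∑ k, a₃ k x * g₃ k x - ∑ k, a₄ k x * g₄ k x - μ * (v.hess 0 0 x + v.hess 1 1 x)
      - ν * v.hess 2 2 x = r x) :
    inner ℝ d v.val + ∑ k, triple (a₁ k) (g₁ k) v.val + ∑ k, triple (a₂ k) (g₂ k) v.val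
      + inner ℝ q v.val - ∑ k, triple (a₃ k) (g₃ k) v.val - ∑ k, triple (a₄ k) (g₄ k) v.val
      - μ * (inner ℝ (v.hess 0 0) v.val + inner ℝ (v.hess 1 1) v.val)
      - ν * inner ℝ (v.hess 2 2) v.val = inner ℝ r v.val := by
  have ht : ∀ {a g : Fin 3 → LTwo L₁ L₂},
      (∀ k, Integrable (fun x => a k x * g k x * v.val x) (cellMeasure L₁ L₂)) →
      IntegratesTo L₁ L₂ (fun x => ∑ k, a k x * g k x * v.val x)
        (∑ k, triple (a k) (g k) v.val) := fun h => IntegratesTo.sum fun k => ⟨h k, rfl⟩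
  refine ((((((((IntegratesTo.inner d v.val).add (ht h₁)).add (ht h₂)).add
    (IntegratesTo.inner q v.val)).sub (ht h₃)).sub (ht h₄)).sub
    (((IntegratesTo.inner (v.hess 0 0) v.val).add (IntegratesTo.inner (v.hess 1 1) v.val)).const_mul
      μ)).sub ((IntegratesTo.inner (v.hess 2 2) v.val).const_mul ν)).unique
    (IntegratesTo.inner r v.val) ?_
  filter_upwards [h] with x hx
  rw [← hx]
  simp only [← Finset.sum_mul]
  ring

/-- Young's inequality with exponents 4/3 and 4 for S^(3/2) X^(1/2), done on squares by completing
one: the cross term of S²(εS - 4KγX/ε)² is the right side of the hypothesis. -/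
lemma abs_le_of_sq_le {I K γ S X ε : ℝ} (hε : 0 < ε)
    (h : I ^ 2 ≤ 8 * K * γ * X * S ^ 3) :
    |I| ≤ ε * S ^ 2 + 8 * K ^ 2 / ε ^ 3 * γ ^ 2 * X ^ 2 := by
  refine abs_le_of_sq_le_sq (h.trans ?_) (by positivity)
  have h1 : (ε * S ^ 2 + 8 * K ^ 2 / ε ^ 3 * γ ^ 2 * X ^ 2) ^ 2 - 8 * K * γ * X * S ^ 3 =
      S ^ 2 * (ε * S - 4 * K * γ / ε * X) ^ 2 + (8 * K ^ 2 / ε ^ 3 * γ ^ 2 * X ^ 2) ^ 2 := by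
    field_simp
    ring
  have h2 : 0 ≤ S ^ 2 * (ε * S - 4 * K * γ / ε * X) ^ 2 +
      (8 * K ^ 2 / ε ^ 3 * γ ^ 2 * X ^ 2) ^ 2 := by positivity
  linarith

/-- The weight `‖g‖ (‖g‖ + ‖g'‖)` with which a coefficient enters the energy inequality. -/
def coeffWeight {L₁ L₂ : ℝ} (g g' : LTwo L₁ L₂) : ℝ := ‖g‖ * (‖g‖ + ‖g'‖)

lemma coeffWeight_nonneg {L₁ L₂ : ℝ} (g g' : LTwo L₁ L₂) : 0 ≤ coeffWeight g g' := by
  unfold coeffWeight; positivity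

/-- With S = X + Y the advecting factor contributes 2S·4S and the tested factor X·S, hence 8γXS³
under the root: at most S^(3/2) in the dissipated quantity, so Young's inequality can absorb it. -/
lemma abs_triple_le {L₁ L₂ : ℝ} (hL₁ : 0 < L₁) (hL₂ : 0 < L₂) {a a' g g' f f' : LTwo L₁ L₂}
    (ha : IsStrongDeriv 2 a a') (hg : IsStrongDeriv 1 g g') (hf : IsStrongDeriv 0 f f')
    {X Y ε : ℝ} (hε : 0 < ε) (hX : 0 ≤ X) (hY : 0 ≤ Y) (h1 : ‖a‖ ≤ 2 * (X + Y))
    (h2 : ‖a'‖ ≤ 2 * (X + Y)) (h3 : ‖f‖ ≤ X) (h4 : ‖f'‖ ≤ Y) :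
    |triple a g f| ≤ ε * (X + Y) ^ 2 +
      8 * trilinearConst L₁ L₂ ^ 2 / ε ^ 3 * coeffWeight g g' ^ 2 * X ^ 2 := by
  have hK := trilinearConst_nonneg hL₁ hL₂
  have hγ := coeffWeight_nonneg g g'
  refine abs_le_of_sq_le hε ((trilinear_estimate hL₁ hL₂ ha hg hf).2.trans ?_)
  have e1 : ‖a‖ * (‖a‖ + ‖a'‖) ≤ 2 * (X + Y) * (2 * (X + Y) + 2 * (X + Y)) := by gcongr
  have e2 : ‖f‖ * (‖f‖ + ‖f'‖) ≤ X * (X + Y) := by gcongr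
  calc trilinearConst L₁ L₂ * (‖a‖ * (‖a‖ + ‖a'‖) * (‖g‖ * (‖g‖ + ‖g'‖)) *
        (‖f‖ * (‖f‖ + ‖f'‖)))
      ≤ trilinearConst L₁ L₂ * (2 * (X + Y) * (2 * (X + Y) + 2 * (X + Y)) *
        (‖g‖ * (‖g‖ + ‖g'‖)) * (X * (X + Y))) := by gcongr
    _ = _ := by unfold coeffWeight; ring

/-- Three-dimensional fields with zero divergence are weakly divergence-free. -/
lemma sum_integral_fderiv_eq_zero {L₁ L₂ : ℝ} {w : Fin 3 → LTwo L₁ L₂} {d₀ d₁ : LTwo L₁ L₂}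
    (h0 : IsWeakDeriv 0 (w 0) d₀) (h1 : IsWeakDeriv 1 (w 1) d₁)
    (h2 : IsWeakDeriv 2 (w 2) (-(d₀ + d₁))) (φ : (Fin 3 → ℝ) → ℝ) (hφ : IsPeriodicTest L₁ L₂ φ) :
    ∑ k, ∫ x, w k x * fderiv ℝ φ x (Pi.single k 1) ∂cellMeasure L₁ L₂ = 0 := by
  rw [Fin.sum_univ_three, h0 φ hφ, h1 φ hφ, h2 φ hφ]
  have h3 : ∫ x, (-(d₀ + d₁) : LTwo L₁ L₂) x * φ x ∂cellMeasure L₁ L₂ =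
      -((∫ x, d₀ x * φ x ∂cellMeasure L₁ L₂) + ∫ x, d₁ x * φ x ∂cellMeasure L₁ L₂) := by
    rw [← integral_add (integrable_mul_of_continuous d₀ hφ.1.continuous)
      (integrable_mul_of_continuous d₁ hφ.1.continuous), ← integral_neg]
    refine integral_congr_ae ?_
    filter_upwards [Lp.coeFn_neg (d₀ + d₁), Lp.coeFn_add d₀ d₁] with x hx hx'
    rw [hx, Pi.neg_apply, hx', Pi.add_apply]
    ring
  rw [h3]
  ring

/-- The pressure gradient does no work. -/
lemma inner_pressure_eq_zero {L₁ L₂ : ℝ} (hL₁ : 0 < L₁) (hL₂ : 0 < L₂) {p : LTwo L₁ L₂}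
    {gp : Fin 3 → LTwo L₁ L₂} (hp : ∀ k, IsWeakDeriv k p (gp k)) (hp2 : gp 2 = 0)
    {u₀ u₁ u₂ d₀ d₁ : LTwo L₁ L₂} (h0 : IsWeakDeriv 0 u₀ d₀) (h1 : IsWeakDeriv 1 u₁ d₁)
    (h2 : IsWeakDeriv 2 u₂ (-(d₀ + d₁))) : inner ℝ (gp 0) u₀ + inner ℝ (gp 1) u₁ = 0 := by
  have e0 := (hp 0).inner_eq_neg hL₁ hL₂ h0
  have e1 := (hp 1).inner_eq_neg hL₁ hL₂ h1
  have e2 := (hp 2).inner_eq_neg hL₁ hL₂ h2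
  rw [hp2, inner_zero_left, neg_zero, inner_neg_right, inner_add_right] at e2
  linarith

/-- `w = (u₁, u₂, w₃)` is the divergence-free field with the horizontal components `u` and an odd
vertical component `w₃`. -/
structure IsFlow {L₁ L₂ : ℝ} (u : Fin 2 → HTwo L₁ L₂) (w : Fin 3 → LTwo L₁ L₂) : Prop where
  zero : w 0 = (u 0).val
  one : w 1 = (u 1).val
  odd : IsOddZ (w 2)
  div : IsWeakDeriv 2 (w 2) (-((u 0).grad 0 + (u 1).grad 1))

namespace IsFlow

variable {L₁ L₂ : ℝ} {u : Fin 2 → HTwo L₁ L₂} {w : Fin 3 → LTwo L₁ L₂}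

/-- The vertical component has no evolution equation of its own: its z-derivative is minus the
horizontal divergence, and oddness bounds the component by that derivative. All three components
thus get the same bound. -/
lemma exists_deriv_norm_le (hL₁ : 0 < L₁) (hL₂ : 0 < L₂) (h : IsFlow u w) {X Y : ℝ} (hX : 0 ≤ X)
    (hY : 0 ≤ Y) (hv : ∀ i, ‖(u i).val‖ ≤ X) (hg : ∀ i k, ‖(u i).grad k‖ ≤ Y) (k : Fin 3) :
    ∃ w', IsStrongDeriv 2 (w k) w' ∧ ‖w k‖ ≤ 2 * (X + Y) ∧ ‖w'‖ ≤ 2 * (X + Y) := by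
  have hu : ∀ i, IsStrongDeriv 2 (u i).val ((u i).grad 2) := fun i =>
    ((u i).isWeakDeriv_grad 2).isStrongDeriv hL₁ hL₂
  have h2 := h.div.isStrongDeriv hL₁ hL₂
  have h3 : ‖-((u 0).grad 0 + (u 1).grad 1)‖ ≤ 2 * (X + Y) := by
    rw [norm_neg]
    refine (norm_add_le _ _).trans ?_
    linarith [hg 0 0, hg 1 1]
  fin_cases k
  · exact ⟨_, by simpa [h.zero] using hu 0, by simpa [h.zero] using (hv 0).trans (by linarith),
      (hg 0 2).trans (by linarith)⟩
  · exact ⟨_, by simpa [h.one] using hu 1, by simpa [h.one] using (hv 1).trans (by linarith),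
      (hg 1 2).trans (by linarith)⟩
  · exact ⟨_, h2, (h.odd.norm_le h2).trans h3, h3⟩

lemma exists_isStrongDeriv (hL₁ : 0 < L₁) (hL₂ : 0 < L₂) (h : IsFlow u w) :
    ∃ w' : Fin 3 → LTwo L₁ L₂, ∀ k, IsStrongDeriv 2 (w k) (w' k) := by
  refine ⟨![(u 0).grad 2, (u 1).grad 2, -((u 0).grad 0 + (u 1).grad 1)], fun k => ?_⟩
  fin_cases k
  · simpa [h.zero] using ((u 0).isWeakDeriv_grad 2).isStrongDeriv hL₁ hL₂
  · simpa [h.one] using ((u 1).isWeakDeriv_grad 2).isStrongDeriv hL₁ hL₂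
  · exact h.div.isStrongDeriv hL₁ hL₂

/-- Transport by a divergence-free field is skew-symmetric. -/
lemma sum_triple_add_eq_zero (hL₁ : 0 < L₁) (hL₂ : 0 < L₂) (h : IsFlow u w) (f g : HTwo L₁ L₂) :
    ∑ k, triple (w k) (f.grad k) g.val + ∑ k, triple (w k) (g.grad k) f.val = 0 := by
  obtain ⟨w', hw'⟩ := h.exists_isStrongDeriv hL₁ hL₂
  rw [← Finset.sum_add_distrib]
  exact integral_transport_add_eq_zero hL₁ hL₂ hw'
    (sum_integral_fderiv_eq_zero (h.zero ▸ (u 0).isWeakDeriv_grad 0)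
      (h.one ▸ (u 1).isWeakDeriv_grad 1) h.div)
    f.isWeakDeriv_grad g.isWeakDeriv_grad (fun k => f.isWeakDeriv_hess k 1)
    (fun k => g.isWeakDeriv_hess k 1)

lemma integrable (hL₁ : 0 < L₁) (hL₂ : 0 < L₂) (h : IsFlow u w) (f g : HTwo L₁ L₂) (k : Fin 3) :
    Integrable (fun x => w k x * f.grad k x * g.val x) (cellMeasure L₁ L₂) := by
  obtain ⟨w', hw'⟩ := h.exists_isStrongDeriv hL₁ hL₂
  exact (trilinear_estimate hL₁ hL₂ (hw' k) ((f.isWeakDeriv_hess k 1).isStrongDeriv hL₁ hL₂)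
    ((g.isWeakDeriv_grad 0).isStrongDeriv hL₁ hL₂)).1

end IsFlow

/-- The constant in front of the coefficients in the energy inequality with dissipation `δ`. -/
def energyConst (L₁ L₂ δ : ℝ) : ℝ := 8 * trilinearConst L₁ L₂ ^ 2 / (δ / 48) ^ 3

/-- The size of the coefficients `U, B` in the energy inequality. -/
def coeffSize {L₁ L₂ : ℝ} (U B : Fin 2 → HTwo L₁ L₂) : ℝ :=
  ∑ i, ∑ k, (coeffWeight ((U i).grad k) ((U i).hess k 1) ^ 2 +
    coeffWeight ((B i).grad k) ((B i).hess k 1) ^ 2)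

section Energy

variable {L₁ L₂ : ℝ}

/-- These are the terms without cancellation, in which the difference field transports the
coefficients `U`, `B`. Each of the two coefficients enters twice, which gives the factor 2. -/
lemma abs_transport_le (hL₁ : 0 < L₁) (hL₂ : 0 < L₂)
    {u b U B : Fin 2 → HTwo L₁ L₂} {w m : Fin 3 → LTwo L₁ L₂} (hw : IsFlow u w) (hm : IsFlow b m)
    {X Y δ : ℝ} (hδ : 0 < δ) (hX : 0 ≤ X) (hY : 0 ≤ Y)
    (hu : ∀ i, ‖(u i).val‖ ≤ X) (hb : ∀ i, ‖(b i).val‖ ≤ X)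
    (hgu : ∀ i k, ‖(u i).grad k‖ ≤ Y) (hgb : ∀ i k, ‖(b i).grad k‖ ≤ Y) :
    -∑ i, (∑ k, triple (w k) ((U i).grad k) (u i).val - ∑ k, triple (m k) ((B i).grad k) (u i).val +
      ∑ k, triple (w k) ((B i).grad k) (b i).val - ∑ k, triple (m k) ((U i).grad k) (b i).val) ≤
      δ / 2 * (X + Y) ^ 2 + 2 * energyConst L₁ L₂ δ * coeffSize U B * X ^ 2 := by
  -- There are 2·3·4 = 24 trilinear terms, together costing δ/2; the later bound (X+Y)² ≤ 2X² + 2Y²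
  -- doubles this to exactly the available dissipation δ.
  have hε : 0 < δ / 48 := by positivity
  have key : ∀ {u' : Fin 2 → HTwo L₁ L₂} {w' : Fin 3 → LTwo L₁ L₂}, IsFlow u' w' →
      (∀ i, ‖(u' i).val‖ ≤ X) → (∀ i k, ‖(u' i).grad k‖ ≤ Y) → ∀ (g f : HTwo L₁ L₂),
      ‖f.val‖ ≤ X → ‖f.grad 0‖ ≤ Y → ∀ k, |triple (w' k) (g.grad k) f.val| ≤
        δ / 48 * (X + Y) ^ 2 +
          energyConst L₁ L₂ δ * coeffWeight (g.grad k) (g.hess k 1) ^ 2 * X ^ 2 := by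
    intro u' w' h h1 h2 g f h3 h4 k
    obtain ⟨w'', hw1, hw2, hw3⟩ := h.exists_deriv_norm_le hL₁ hL₂ hX hY h1 h2 k
    exact abs_triple_le hL₁ hL₂ hw1 ((g.isWeakDeriv_hess k 1).isStrongDeriv hL₁ hL₂)
      ((f.isWeakDeriv_grad 0).isStrongDeriv hL₁ hL₂) hε hX hY hw2 hw3 h3 h4
  have hik : ∀ i k, -(triple (w k) ((U i).grad k) (u i).val -
      triple (m k) ((B i).grad k) (u i).val +
      triple (w k) ((B i).grad k) (b i).val - triple (m k) ((U i).grad k) (b i).val) ≤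
      δ / 12 * (X + Y) ^ 2 + 2 * energyConst L₁ L₂ δ *
        (coeffWeight ((U i).grad k) ((U i).hess k 1) ^ 2 +
        coeffWeight ((B i).grad k) ((B i).hess k 1) ^ 2) * X ^ 2 := by
    intro i k
    have k1 := neg_le_of_abs_le (key hw hu hgu (U i) (u i) (hu i) (hgu i 0) k)
    have k2 := le_of_abs_le (key hm hb hgb (B i) (u i) (hu i) (hgu i 0) k)
    have k3 := neg_le_of_abs_le (key hw hu hgu (B i) (b i) (hb i) (hgb i 0) k)
    have k4 := le_of_abs_le (key hm hb hgb (U i) (b i) (hb i) (hgb i 0) k)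
    linarith
  have hsum := Finset.sum_le_sum fun i (_ : i ∈ Finset.univ) =>
    Finset.sum_le_sum fun k (_ : k ∈ Finset.univ) => hik i k
  calc _ = ∑ i, ∑ k, -(triple (w k) ((U i).grad k) (u i).val
        - triple (m k) ((B i).grad k) (u i).val + triple (w k) ((B i).grad k) (b i).val
        - triple (m k) ((U i).grad k) (b i).val) := by
        simp only [Finset.sum_neg_distrib, Finset.sum_sub_distrib, Finset.sum_add_distrib]
    _ ≤ _ := hsum
    _ = _ := by
        simp only [coeffSize, Finset.sum_add_distrib, ← Finset.mul_sum, ← Finset.sum_mul,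
          Finset.sum_const, Finset.card_univ, Fintype.card_fin, nsmul_eq_mul]
        push_cast
        ring

/-- The energy inequality for the linearised system at a fixed time. -/
theorem energy_inequality (hL₁ : 0 < L₁) (hL₂ : 0 < L₂) {μ ν : ℝ} (hμ : 0 < μ) (hν : 0 < ν)
    {u b U B v c : Fin 2 → HTwo L₁ L₂} {w m V M : Fin 3 → LTwo L₁ L₂} (hw : IsFlow u w)
    (hm : IsFlow b m) (hV : IsFlow v V) (hM : IsFlow c M) {p : LTwo L₁ L₂}
    {gp : Fin 3 → LTwo L₁ L₂} (hp : ∀ k, IsWeakDeriv k p (gp k)) (hp2 : gp 2 = 0)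
    {du db ru rb : Fin 2 → LTwo L₁ L₂}
    (hu : ∀ i, ∀ᵐ x ∂cellMeasure L₁ L₂, du i x + ∑ k, w k x * (U i).grad k x
      + ∑ k, V k x * (u i).grad k x + gp i.castSucc x - ∑ k, m k x * (B i).grad k x
      - ∑ k, M k x * (b i).grad k x - μ * ((u i).hess 0 0 x + (u i).hess 1 1 x)
      - ν * (u i).hess 2 2 x = ru i x)
    (hb : ∀ i, ∀ᵐ x ∂cellMeasure L₁ L₂, db i x + ∑ k, w k x * (B i).grad k x
      + ∑ k, V k x * (b i).grad k x - ∑ k, m k x * (U i).grad k x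
      - ∑ k, M k x * (u i).grad k x - μ * ((b i).hess 0 0 x + (b i).hess 1 1 x)
      - ν * (b i).hess 2 2 x = rb i x) :
    ∑ i, (inner ℝ (du i) (u i).val + inner ℝ (db i) (b i).val) ≤
      ∑ i, (inner ℝ (ru i) (u i).val + inner ℝ (rb i) (b i).val) +
      (min μ ν + 2 * energyConst L₁ L₂ (min μ ν) * coeffSize U B) *
        ∑ i, (‖(u i).val‖ ^ 2 + ‖(b i).val‖ ^ 2) := by
  have hδ : 0 < min μ ν := lt_min hμ hν
  set δ := min μ ν with hδdef
  have eu : ∀ i, _ := fun i => inner_eq_of_equation (u i) (hw.integrable hL₁ hL₂ (U i) (u i))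
    (hV.integrable hL₁ hL₂ (u i) (u i)) (hm.integrable hL₁ hL₂ (B i) (u i))
    (hM.integrable hL₁ hL₂ (b i) (u i)) (hu i)
  -- The induction equation has no pressure, so a zero takes its place.
  have eb : ∀ i, _ := fun i => inner_eq_of_equation (q := 0) (b i)
    (hw.integrable hL₁ hL₂ (B i) (b i)) (hV.integrable hL₁ hL₂ (b i) (b i))
    (hm.integrable hL₁ hL₂ (U i) (b i)) (hM.integrable hL₁ hL₂ (u i) (b i)) (d := db i) (r := rb i)
    (μ := μ) (ν := ν) (by
      filter_upwards [hb i, Lp.coeFn_zero ℝ 2 (cellMeasure L₁ L₂)] with x hx h0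
      rw [h0, Pi.zero_apply, add_zero]
      exact hx)
  simp only [HTwo.inner_hess hL₁ hL₂, inner_zero_left] at eu eb
  -- Skew-symmetry with equal arguments yields twice the same sum.
  have cV : ∀ i, ∑ k, triple (V k) ((u i).grad k) (u i).val = 0 ∧
      ∑ k, triple (V k) ((b i).grad k) (b i).val = 0 := fun i =>
    ⟨by linarith [hV.sum_triple_add_eq_zero hL₁ hL₂ (u i) (u i)],
      by linarith [hV.sum_triple_add_eq_zero hL₁ hL₂ (b i) (b i)]⟩
  -- The magnetic transport terms are not zero one by one: the one in the equation for `u i` cancels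
  -- against the one in the equation for `b i`.
  have cM := fun i => hM.sum_triple_add_eq_zero hL₁ hL₂ (u i) (b i)
  have hpr := inner_pressure_eq_zero hL₁ hL₂ hp hp2 ((u 0).isWeakDeriv_grad 0)
    ((u 1).isWeakDeriv_grad 1) hw.div
  set X2 := ∑ i, (‖(u i).val‖ ^ 2 + ‖(b i).val‖ ^ 2) with hX2
  set Y2 := ∑ i, ∑ k, (‖(u i).grad k‖ ^ 2 + ‖(b i).grad k‖ ^ 2) with hY2
  have hX2n : 0 ≤ X2 := Finset.sum_nonneg fun i _ => by positivity
  have hY2n : 0 ≤ Y2 := Finset.sum_nonneg fun i _ => Finset.sum_nonneg fun k _ => by positivity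
  have hX2i : ∀ i, ‖(u i).val‖ ^ 2 + ‖(b i).val‖ ^ 2 ≤ X2 := fun i =>
    Finset.single_le_sum (f := fun i => ‖(u i).val‖ ^ 2 + ‖(b i).val‖ ^ 2)
      (fun i _ => by positivity) (Finset.mem_univ i)
  have hY2i : ∀ i k, ‖(u i).grad k‖ ^ 2 + ‖(b i).grad k‖ ^ 2 ≤ Y2 := fun i k =>
    (Finset.single_le_sum (f := fun k => ‖(u i).grad k‖ ^ 2 + ‖(b i).grad k‖ ^ 2)
      (fun k _ => by positivity) (Finset.mem_univ k)).trans
    (Finset.single_le_sum (f := fun i => ∑ k, (‖(u i).grad k‖ ^ 2 + ‖(b i).grad k‖ ^ 2))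
      (fun i _ => Finset.sum_nonneg fun k _ => by positivity) (Finset.mem_univ i))
  have hbad := abs_transport_le hL₁ hL₂ (U := U) (B := B) hw hm hδ (Real.sqrt_nonneg X2)
    (Real.sqrt_nonneg Y2)
    (fun i => Real.le_sqrt_of_sq_le ((le_add_of_nonneg_right (sq_nonneg _)).trans (hX2i i)))
    (fun i => Real.le_sqrt_of_sq_le ((le_add_of_nonneg_left (sq_nonneg _)).trans (hX2i i)))
    (fun i k => Real.le_sqrt_of_sq_le ((le_add_of_nonneg_right (sq_nonneg _)).trans (hY2i i k)))
    (fun i k => Real.le_sqrt_of_sq_le ((le_add_of_nonneg_left (sq_nonneg _)).trans (hY2i i k)))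
  rw [Real.sq_sqrt hX2n] at hbad
  have hS : (√X2 + √Y2) ^ 2 ≤ 2 * X2 + 2 * Y2 := by
    nlinarith [sq_nonneg (√X2 - √Y2), Real.sq_sqrt hX2n, Real.sq_sqrt hY2n]
  have hdiss : δ * Y2 ≤ ∑ i, (μ * (‖(u i).grad 0‖ ^ 2 + ‖(u i).grad 1‖ ^ 2)
      + ν * ‖(u i).grad 2‖ ^ 2 + μ * (‖(b i).grad 0‖ ^ 2 + ‖(b i).grad 1‖ ^ 2)
      + ν * ‖(b i).grad 2‖ ^ 2) := by
    rw [hY2, Finset.mul_sum]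
    refine Finset.sum_le_sum fun i _ => ?_
    have h1 : δ ≤ μ := min_le_left _ _
    have h2 : δ ≤ ν := min_le_right _ _
    rw [Fin.sum_univ_three]
    have := mul_le_mul_of_nonneg_right h1 (add_nonneg (add_nonneg (sq_nonneg ‖(u i).grad 0‖)
      (sq_nonneg ‖(u i).grad 1‖)) (add_nonneg (sq_nonneg ‖(b i).grad 0‖)
      (sq_nonneg ‖(b i).grad 1‖)))
    have := mul_le_mul_of_nonneg_right h2 (add_nonneg (sq_nonneg ‖(u i).grad 2‖)
      (sq_nonneg ‖(b i).grad 2‖))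
    linarith
  have hS' := mul_le_mul_of_nonneg_left hS (by positivity : 0 ≤ δ / 2)
  have eu0 := eu 0
  have eu1 := eu 1
  have eb0 := eb 0
  have eb1 := eb 1
  have cM0 := cM 0
  have cM1 := cM 1
  rw [(cV 0).1] at eu0
  rw [(cV 1).1] at eu1
  rw [(cV 0).2] at eb0
  rw [(cV 1).2] at eb1
  simp only [Fin.sum_univ_two, Fin.castSucc_zero, Fin.castSucc_one] at hbad hdiss eu0 eu1 ⊢
  linarith

end Energy

/-! ### Difference quotients of solutions -/

section Solutions

variable {L₁ L₂ T : ℝ}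

lemma StrongScalar.integrable_dt (f : StrongScalar L₁ L₂ T) :
    Integrable f.dt (volume.restrict (Ioo 0 T)) := f.dt_memLp.integrable (by norm_num)

lemma StrongScalar.intervalIntegrable_dt (f : StrongScalar L₁ L₂ T) {t : ℝ} (ht : t ∈ Icc 0 T) :
    IntervalIntegrable f.dt volume 0 t := by
  rw [intervalIntegrable_iff_integrableOn_Ioo_of_le ht.1]
  exact IntegrableOn.mono_set f.integrable_dt (Ioo_subset_Ioo_right ht.2)

/-- The scaled difference `c (f - g)`. -/
def StrongScalar.smulSub (c : ℝ) (f g : StrongScalar L₁ L₂ T) : StrongScalar L₁ L₂ T where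
  val t := c • (f.val t - g.val t)
  grad t k := c • (f.grad t k - g.grad t k)
  hess t j k := c • (f.hess t j k - g.hess t j k)
  dt t := c • (f.dt t - g.dt t)
  even t ht := ((f.even t ht).sub (quasiMeasurePreserving_reflectZ L₁ L₂) (g.even t ht)).const_smul
    (quasiMeasurePreserving_reflectZ L₁ L₂) c
  val_continuousOn := (f.val_continuousOn.sub g.val_continuousOn).const_smul c
  grad_continuousOn k := ((f.grad_continuousOn k).sub (g.grad_continuousOn k)).const_smul c
  isWeakDeriv_grad t ht k :=
    ((f.isWeakDeriv_grad t ht k).sub (g.isWeakDeriv_grad t ht k)).const_smul c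
  hess_memLp j k := ((f.hess_memLp j k).sub (g.hess_memLp j k)).const_smul c
  isWeakDeriv_hess := by
    filter_upwards [f.isWeakDeriv_hess, g.isWeakDeriv_hess] with t hf hg j k
    exact ((hf j k).sub (hg j k)).const_smul c
  dt_memLp := (f.dt_memLp.sub g.dt_memLp).const_smul c
  val_eq_integral t ht := by
    rw [intervalIntegral.integral_smul, intervalIntegral.integral_sub (f.intervalIntegrable_dt ht)
      (g.intervalIntegrable_dt ht), f.val_eq_integral t ht, g.val_eq_integral t ht, ← smul_add]
    congr 1
    abel

/-- The scaled difference `c (F - G)`. -/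
def Fields.smulSub (c : ℝ) (F G : Fields L₁ L₂ T) : Fields L₁ L₂ T where
  u i := (F.u i).smulSub c (G.u i)
  b i := (F.b i).smulSub c (G.b i)
  u₃ t := c • (F.u₃ t - G.u₃ t)
  b₃ t := c • (F.b₃ t - G.b₃ t)
  u₃_odd t ht := ((F.u₃_odd t ht).sub (quasiMeasurePreserving_reflectZ L₁ L₂)
    (G.u₃_odd t ht)).const_smul (quasiMeasurePreserving_reflectZ L₁ L₂) c
  b₃_odd t ht := ((F.b₃_odd t ht).sub (quasiMeasurePreserving_reflectZ L₁ L₂)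
    (G.b₃_odd t ht)).const_smul (quasiMeasurePreserving_reflectZ L₁ L₂) c
  p t := c • (F.p t - G.p t)
  gradp t k := c • (F.gradp t k - G.gradp t k)
  p_memLp := (F.p_memLp.sub G.p_memLp).const_smul c
  gradp_memLp k := ((F.gradp_memLp k).sub (G.gradp_memLp k)).const_smul c
  isWeakDeriv_gradp := by
    filter_upwards [F.isWeakDeriv_gradp, G.isWeakDeriv_gradp] with t hF hG k
    exact ((hF k).sub (hG k)).const_smul c

lemma Fields.smulSub_vel (c : ℝ) (F G : Fields L₁ L₂ T) (t : ℝ) (k : Fin 3) :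
    (F.smulSub c G).vel t k = c • (F.vel t k - G.vel t k) := by
  fin_cases k <;> rfl

lemma Fields.smulSub_mag (c : ℝ) (F G : Fields L₁ L₂ T) (t : ℝ) (k : Fin 3) :
    (F.smulSub c G).mag t k = c • (F.mag t k - G.mag t k) := by
  fin_cases k <;> rfl

lemma isWeakDeriv_smul_sub_div {c : ℝ} {w w' a a' d d' : LTwo L₁ L₂}
    (h : IsWeakDeriv 2 w (-(a + d))) (h' : IsWeakDeriv 2 w' (-(a' + d'))) :
    IsWeakDeriv 2 (c • (w - w')) (-(c • (a - a') + c • (d - d'))) := by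
  convert (h.sub h').const_smul c using 1
  rw [← smul_add, ← smul_neg]
  congr 1
  abel

lemma Fields.IsConstrained.smulSub (c : ℝ) {F G : Fields L₁ L₂ T} (hF : F.IsConstrained)
    (hG : G.IsConstrained) : (F.smulSub c G).IsConstrained where
  pressure := by
    filter_upwards [hF.pressure, hG.pressure] with t h1 h2
    change c • (F.gradp t 2 - G.gradp t 2) = 0
    rw [h1, h2, sub_zero, smul_zero]
  div_u t ht := isWeakDeriv_smul_sub_div (hF.div_u t ht) (hG.div_u t ht)
  div_b t ht := isWeakDeriv_smul_sub_div (hF.div_b t ht) (hG.div_b t ht)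

lemma coeFn_smul_sub (c : ℝ) (f g : LTwo L₁ L₂) :
    ∀ᵐ x ∂cellMeasure L₁ L₂, (c • (f - g) : LTwo L₁ L₂) x = c * (f x - g x) := by
  filter_upwards [Lp.coeFn_smul c (f - g), Lp.coeFn_sub f g] with x h1 h2
  rw [h1, Pi.smul_apply, h2, Pi.sub_apply, smul_eq_mul]

lemma IsAssimilationSolution.isDifferenceQuotientSolution {μ₁ μ₂ ν βu βb : ℝ} (hμ : μ₁ ≠ μ₂)
    {I : LTwo L₁ L₂ →ₗ[ℝ] LTwo L₁ L₂} {R F₁ F₂ : Fields L₁ L₂ T}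
    (h₁ : IsAssimilationSolution μ₁ ν βu βb I R F₁)
    (h₂ : IsAssimilationSolution μ₂ ν βu βb I R F₂) :
    IsDifferenceQuotientSolution μ₁ μ₂ ν βu βb I F₁ F₂ (F₁.smulSub (μ₁ - μ₂)⁻¹ F₂) where
  constrained := h₁.constrained.smulSub _ h₂.constrained
  momentum := by
    filter_upwards [h₁.momentum, h₂.momentum] with t e₁ e₂ i
    set c := (μ₁ - μ₂)⁻¹ with hc
    have hcμ : c * (μ₁ - μ₂) = 1 := inv_mul_cancel₀ (sub_ne_zero.2 hμ)
    filter_upwards [e₁ i, e₂ i, coeFn_smul_sub c ((F₁.u i).dt t) ((F₂.u i).dt t),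
      ae_all_iff.2 fun k => coeFn_smul_sub c (F₁.vel t k) (F₂.vel t k),
      ae_all_iff.2 fun k => coeFn_smul_sub c (F₁.mag t k) (F₂.mag t k),
      ae_all_iff.2 fun k => coeFn_smul_sub c ((F₁.u i).grad t k) ((F₂.u i).grad t k),
      ae_all_iff.2 fun k => coeFn_smul_sub c ((F₁.b i).grad t k) ((F₂.b i).grad t k),
      ae_all_iff.2 fun k => coeFn_smul_sub c ((F₁.u i).hess t k k) ((F₂.u i).hess t k k),
      coeFn_smul_sub c (F₁.gradp t i.castSucc) (F₂.gradp t i.castSucc),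
      coeFn_smul_sub c (I ((F₁.u i).val t)) (I ((F₂.u i).val t))]
      with x q₁ q₂ x1 x2 x3 x4 x5 x6 x7 x8
    have hI : I (((F₁.smulSub c F₂).u i).val t) =
        c • (I ((F₁.u i).val t) - I ((F₂.u i).val t)) := by
      rw [← map_sub, ← map_smul]; rfl
    rw [hI, x8]
    simp only [transport, lapH, dzz, Fields.smulSub_vel, Fields.smulSub_mag, x2, x3] at q₁ q₂ ⊢
    simp only [Fields.smulSub, StrongScalar.smulSub, x1, x4, x5, x6, x7, Fin.sum_univ_three]
      at q₁ q₂ ⊢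
    -- The last term uses c(μ₁ - μ₂) = 1 and produces the source, the horizontal Laplacian of the
    -- first solution.
    linear_combination c * q₁ - c * q₂ +
      ((F₁.u i).hess t 0 0 x + (F₁.u i).hess t 1 1 x) * hcμ
  induction := by
    filter_upwards [h₁.induction, h₂.induction] with t e₁ e₂ i
    set c := (μ₁ - μ₂)⁻¹ with hc
    have hcμ : c * (μ₁ - μ₂) = 1 := inv_mul_cancel₀ (sub_ne_zero.2 hμ)
    filter_upwards [e₁ i, e₂ i, coeFn_smul_sub c ((F₁.b i).dt t) ((F₂.b i).dt t),
      ae_all_iff.2 fun k => coeFn_smul_sub c (F₁.vel t k) (F₂.vel t k),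
      ae_all_iff.2 fun k => coeFn_smul_sub c (F₁.mag t k) (F₂.mag t k),
      ae_all_iff.2 fun k => coeFn_smul_sub c ((F₁.u i).grad t k) ((F₂.u i).grad t k),
      ae_all_iff.2 fun k => coeFn_smul_sub c ((F₁.b i).grad t k) ((F₂.b i).grad t k),
      ae_all_iff.2 fun k => coeFn_smul_sub c ((F₁.b i).hess t k k) ((F₂.b i).hess t k k),
      coeFn_smul_sub c (I ((F₁.b i).val t)) (I ((F₂.b i).val t))]
      with x q₁ q₂ x1 x2 x3 x4 x5 x6 x8
    have hI : I (((F₁.smulSub c F₂).b i).val t) =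
        c • (I ((F₁.b i).val t) - I ((F₂.b i).val t)) := by
      rw [← map_sub, ← map_smul]; rfl
    rw [hI, x8]
    simp only [transport, lapH, dzz, Fields.smulSub_vel, Fields.smulSub_mag, x2, x3] at q₁ q₂ ⊢
    simp only [Fields.smulSub, StrongScalar.smulSub, x1, x4, x5, x6, Fin.sum_univ_three]
      at q₁ q₂ ⊢
    linear_combination c * q₁ - c * q₂ +
      ((F₁.b i).hess t 0 0 x + (F₁.b i).hess t 1 1 x) * hcμ
  initial_u i := rfl
  initial_b i := rfl

/-! ### Uniqueness -/

/-- The value of a strong scalar at a time at which it lies in `H²`. -/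
def StrongScalar.htwo (f : StrongScalar L₁ L₂ T) {t : ℝ} (ht : t ∈ Icc 0 T)
    (h : ∀ j k, IsWeakDeriv k (f.grad t j) (f.hess t j k)) : HTwo L₁ L₂ where
  val := f.val t
  grad := f.grad t
  hess := f.hess t
  isWeakDeriv_grad := f.isWeakDeriv_grad t ht
  isWeakDeriv_hess := h

lemma IsFlow.sub {u u' : Fin 2 → HTwo L₁ L₂} {w w' : Fin 3 → LTwo L₁ L₂} (h : IsFlow u w)
    (h' : IsFlow u' w') : IsFlow (fun i => (u i).sub (u' i)) (fun k => w k - w' k) where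
  zero := by rw [h.zero, h'.zero]; rfl
  one := by rw [h.one, h'.one]; rfl
  odd := h.odd.sub (quasiMeasurePreserving_reflectZ L₁ L₂) h'.odd
  div := by
    convert h.div.sub h'.div using 1
    simp only [HTwo.sub]
    abel

lemma Fields.IsConstrained.isFlow_vel {F : Fields L₁ L₂ T} (hF : F.IsConstrained) {t : ℝ}
    (ht : t ∈ Icc 0 T)
    (h : ∀ i j k, IsWeakDeriv k ((F.u i).grad t j) ((F.u i).hess t j k)) :
    IsFlow (fun i => (F.u i).htwo ht (h i)) (F.vel t) :=
  ⟨rfl, rfl, F.u₃_odd t ht, hF.div_u t ht⟩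

lemma Fields.IsConstrained.isFlow_mag {F : Fields L₁ L₂ T} (hF : F.IsConstrained) {t : ℝ}
    (ht : t ∈ Icc 0 T)
    (h : ∀ i j k, IsWeakDeriv k ((F.b i).grad t j) ((F.b i).hess t j k)) :
    IsFlow (fun i => (F.b i).htwo ht (h i)) (F.mag t) :=
  ⟨rfl, rfl, F.b₃_odd t ht, hF.div_b t ht⟩

lemma Fields.ae_isWeakDeriv_hess (F : Fields L₁ L₂ T) :
    ∀ᵐ t ∂(volume.restrict (Ioo 0 T)), ∀ i : Fin 2,
      (∀ j k, IsWeakDeriv k ((F.u i).grad t j) ((F.u i).hess t j k)) ∧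
      ∀ j k, IsWeakDeriv k ((F.b i).grad t j) ((F.b i).hess t j k) :=
  ae_all_iff.2 fun i => (F.u i).isWeakDeriv_hess.and (F.b i).isWeakDeriv_hess

/-- The gradient is bounded in L² by continuity on the compact time interval, so the square grows
only quadratically in the second derivative, which is square integrable in time. -/
lemma StrongScalar.integrable_coeffWeight_sq (f : StrongScalar L₁ L₂ T) (j k : Fin 3) :
    Integrable (fun t => coeffWeight (f.grad t j) (f.hess t j k) ^ 2)
      (volume.restrict (Ioo 0 T)) := by
  obtain ⟨M, hM⟩ := isCompact_Icc.exists_bound_of_continuousOn (f.grad_continuousOn j)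
  have m1 : AEStronglyMeasurable (fun t => f.grad t j) (volume.restrict (Ioo 0 T)) :=
    ((f.grad_continuousOn j).mono Ioo_subset_Icc_self).aestronglyMeasurable measurableSet_Ioo
  have m2 := (f.hess_memLp j k).aestronglyMeasurable
  have hb : Integrable (fun t => 2 * M ^ 2 * (M ^ 2 + ‖f.hess t j k‖ ^ 2))
      (volume.restrict (Ioo 0 T)) :=
    ((integrable_const _).add ((f.hess_memLp j k).integrable_norm_pow (by norm_num))).const_mul _
  refine hb.mono' ((m1.norm.mul (m1.norm.add m2.norm)).pow 2) ?_
  filter_upwards [ae_restrict_mem measurableSet_Ioo] with t ht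
  have h1 := hM t (Ioo_subset_Icc_self ht)
  rw [Real.norm_eq_abs, abs_of_nonneg (sq_nonneg _), coeffWeight, mul_pow]
  have h2 : ‖f.grad t j‖ ^ 2 ≤ M ^ 2 := by gcongr
  have h3 : (‖f.grad t j‖ + ‖f.hess t j k‖) ^ 2 ≤ 2 * (M ^ 2 + ‖f.hess t j k‖ ^ 2) := by
    nlinarith [sq_nonneg (‖f.grad t j‖ - ‖f.hess t j k‖)]
  calc _ ≤ M ^ 2 * (2 * (M ^ 2 + ‖f.hess t j k‖ ^ 2)) := by gcongr
    _ = _ := by ring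

/-- The size of the coefficients of the difference quotient system at time `t`. -/
def Fields.coeffSize (F : Fields L₁ L₂ T) (t : ℝ) : ℝ :=
  ∑ i, ∑ k, (coeffWeight ((F.u i).grad t k) ((F.u i).hess t k 1) ^ 2 +
    coeffWeight ((F.b i).grad t k) ((F.b i).hess t k 1) ^ 2)

lemma Fields.integrable_coeffSize (F : Fields L₁ L₂ T) :
    Integrable F.coeffSize (volume.restrict (Ioo 0 T)) :=
  integrable_finsetSum _ fun i _ => integrable_finsetSum _ fun k _ =>
    ((F.u i).integrable_coeffWeight_sq k 1).add ((F.b i).integrable_coeffWeight_sq k 1)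

/-- For uniqueness the nudging term need not be dissipative: L² boundedness of `I` makes it a
lower-order term for Grönwall, with no smallness condition on β or h. -/
lemma IsInterpolant.neg_inner_le {c₁ c₂ h : ℝ} {I : LTwo L₁ L₂ →ₗ[ℝ] LTwo L₁ L₂}
    (hI : IsInterpolant c₁ c₂ h I) {β : ℝ} (hβ : 0 ≤ β) (w : LTwo L₁ L₂) :
    inner ℝ (-β • I w) w ≤ β * c₂ * ‖w‖ ^ 2 := by
  rw [real_inner_smul_left, neg_mul, ← mul_neg]
  have h1 : -inner ℝ (I w) w ≤ c₂ * ‖w‖ ^ 2 :=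
    calc -inner ℝ (I w) w ≤ |inner ℝ (I w) w| := neg_le_abs _
      _ ≤ ‖I w‖ * ‖w‖ := abs_real_inner_le_norm _ _
      _ ≤ c₂ * ‖w‖ * ‖w‖ := by gcongr; exact hI.bounded w
      _ = _ := by ring
  exact (mul_le_mul_of_nonneg_left h1 hβ).trans_eq (by ring)

/-- The energy inequality for the difference of two solutions of the difference quotient system. -/
lemma IsDifferenceQuotientSolution.inner_le (hL₁ : 0 < L₁) (hL₂ : 0 < L₂)
    {μ₁ μ₂ ν βu βb c₁ c₂ h : ℝ} (hμ₂ : 0 < μ₂) (hν : 0 < ν) (hβu : 0 < βu) (hβb : 0 < βb)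
    {I : LTwo L₁ L₂ →ₗ[ℝ] LTwo L₁ L₂} (hI : IsInterpolant c₁ c₂ h I) {F₁ F₂ D D' : Fields L₁ L₂ T}
    (h₂ : F₂.IsConstrained)
    (hD : IsDifferenceQuotientSolution μ₁ μ₂ ν βu βb I F₁ F₂ D)
    (hD' : IsDifferenceQuotientSolution μ₁ μ₂ ν βu βb I F₁ F₂ D') :
    ∀ᵐ t ∂(volume.restrict (Ioo 0 T)),
      ∑ i, (inner ℝ ((D'.u i).dt t - (D.u i).dt t) ((D'.u i).val t - (D.u i).val t) +
        inner ℝ ((D'.b i).dt t - (D.b i).dt t) ((D'.b i).val t - (D.b i).val t)) ≤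
      ((βu + βb) * |c₂| + min μ₂ ν + 2 * energyConst L₁ L₂ (min μ₂ ν) * F₁.coeffSize t) *
        ∑ i, (‖(D'.u i).val t - (D.u i).val t‖ ^ 2 + ‖(D'.b i).val t - (D.b i).val t‖ ^ 2) := by
  filter_upwards [ae_restrict_mem measurableSet_Ioo, D.ae_isWeakDeriv_hess, D'.ae_isWeakDeriv_hess,
    F₁.ae_isWeakDeriv_hess, F₂.ae_isWeakDeriv_hess, D.isWeakDeriv_gradp, D'.isWeakDeriv_gradp,
    hD.constrained.pressure, hD'.constrained.pressure, hD.momentum, hD'.momentum, hD.induction,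
    hD'.induction] with t ht' wD wD' w₁ w₂ pD pD' zD zD' mD mD' iD iD'
  have ht : t ∈ Icc 0 T := Ioo_subset_Icc_self ht'
  have key := energy_inequality hL₁ hL₂ hμ₂ hν
    (U := fun i => (F₁.u i).htwo ht (w₁ i).1) (B := fun i => (F₁.b i).htwo ht (w₁ i).2)
    ((hD'.constrained.isFlow_vel ht fun i => (wD' i).1).sub
      (hD.constrained.isFlow_vel ht fun i => (wD i).1))
    ((hD'.constrained.isFlow_mag ht fun i => (wD' i).2).sub
      (hD.constrained.isFlow_mag ht fun i => (wD i).2))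
    (h₂.isFlow_vel ht fun i => (w₂ i).1) (h₂.isFlow_mag ht fun i => (w₂ i).2)
    (fun k => (pD' k).sub (pD k)) (by rw [zD, zD', sub_zero])
    (du := fun i => (D'.u i).dt t - (D.u i).dt t) (db := fun i => (D'.b i).dt t - (D.b i).dt t)
    (ru := fun i => -βu • I ((D'.u i).val t - (D.u i).val t))
    (rb := fun i => -βb • I ((D'.b i).val t - (D.b i).val t))
    (fun i => by
      filter_upwards [mD i, mD' i, Lp.coeFn_sub ((D'.u i).dt t) ((D.u i).dt t),
        ae_all_iff.2 fun k => Lp.coeFn_sub (D'.vel t k) (D.vel t k),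
        ae_all_iff.2 fun k => Lp.coeFn_sub (D'.mag t k) (D.mag t k),
        ae_all_iff.2 fun k => Lp.coeFn_sub ((D'.u i).grad t k) ((D.u i).grad t k),
        ae_all_iff.2 fun k => Lp.coeFn_sub ((D'.b i).grad t k) ((D.b i).grad t k),
        ae_all_iff.2 fun k => Lp.coeFn_sub ((D'.u i).hess t k k) ((D.u i).hess t k k),
        Lp.coeFn_sub (D'.gradp t i.castSucc) (D.gradp t i.castSucc),
        coeFn_smul_sub (-βu) (I ((D'.u i).val t)) (I ((D.u i).val t))]
        with x q q' x1 x2 x3 x4 x5 x6 x7 x8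
      rw [map_sub, x8]
      simp only [transport, lapH, dzz, HTwo.sub, StrongScalar.htwo, x1, x2, x3, x4, x5, x6, x7,
        Pi.sub_apply, Fin.sum_univ_three] at q q' ⊢
      -- The source from the first assimilation solution appears in both equations and drops out;
      -- everything else is linear in the unknown.
      linear_combination q' - q)
    (fun i => by
      filter_upwards [iD i, iD' i, Lp.coeFn_sub ((D'.b i).dt t) ((D.b i).dt t),
        ae_all_iff.2 fun k => Lp.coeFn_sub (D'.vel t k) (D.vel t k),
        ae_all_iff.2 fun k => Lp.coeFn_sub (D'.mag t k) (D.mag t k),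
        ae_all_iff.2 fun k => Lp.coeFn_sub ((D'.u i).grad t k) ((D.u i).grad t k),
        ae_all_iff.2 fun k => Lp.coeFn_sub ((D'.b i).grad t k) ((D.b i).grad t k),
        ae_all_iff.2 fun k => Lp.coeFn_sub ((D'.b i).hess t k k) ((D.b i).hess t k k),
        coeFn_smul_sub (-βb) (I ((D'.b i).val t)) (I ((D.b i).val t))]
        with x q q' x1 x2 x3 x4 x5 x6 x8
      rw [map_sub, x8]
      simp only [transport, lapH, dzz, HTwo.sub, StrongScalar.htwo, x1, x2, x3, x4, x5, x6,
        Pi.sub_apply, Fin.sum_univ_three] at q q' ⊢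
      linear_combination q' - q)
  refine key.trans ?_
  have hr : ∑ i, (inner ℝ (-βu • I ((D'.u i).val t - (D.u i).val t))
        ((D'.u i).val t - (D.u i).val t) + inner ℝ (-βb • I ((D'.b i).val t - (D.b i).val t))
        ((D'.b i).val t - (D.b i).val t)) ≤ (βu + βb) * |c₂| *
        ∑ i, (‖(D'.u i).val t - (D.u i).val t‖ ^ 2 + ‖(D'.b i).val t - (D.b i).val t‖ ^ 2) := by
    rw [Finset.mul_sum]
    refine Finset.sum_le_sum fun i _ => ?_
    rw [mul_add]
    -- The constant `c₂` has no assumed sign, hence the absolute value; βu + βb serves both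
    -- equations.
    have hc : ∀ β, 0 ≤ β → β ≤ βu + βb → β * c₂ ≤ (βu + βb) * |c₂| := fun β h1 h2 =>
      (mul_le_mul_of_nonneg_left (le_abs_self c₂) h1).trans
        (mul_le_mul_of_nonneg_right h2 (abs_nonneg _))
    refine add_le_add ((hI.neg_inner_le hβu.le _).trans ?_) ((hI.neg_inner_le hβb.le _).trans ?_)
    · exact mul_le_mul_of_nonneg_right (hc βu hβu.le (by linarith)) (sq_nonneg _)
    · exact mul_le_mul_of_nonneg_right (hc βb hβb.le (by linarith)) (sq_nonneg _)
  refine (add_le_add_left hr _).trans_eq ?_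
  simp only [HTwo.sub, StrongScalar.htwo, PEM.coeffSize, Fields.coeffSize]
  ring

theorem IsDifferenceQuotientSolution.unique (hL₁ : 0 < L₁) (hL₂ : 0 < L₂) (hT : 0 < T)
    {μ₁ μ₂ ν βu βb c₁ c₂ h : ℝ} (hμ₂ : 0 < μ₂) (hν : 0 < ν) (hβu : 0 < βu) (hβb : 0 < βb)
    {I : LTwo L₁ L₂ →ₗ[ℝ] LTwo L₁ L₂} (hI : IsInterpolant c₁ c₂ h I) {F₁ F₂ D D' : Fields L₁ L₂ T}
    (h₂ : F₂.IsConstrained)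
    (hD : IsDifferenceQuotientSolution μ₁ μ₂ ν βu βb I F₁ F₂ D)
    (hD' : IsDifferenceQuotientSolution μ₁ μ₂ ν βu βb I F₁ F₂ D') :
    ∀ t ∈ Icc 0 T, ∀ i, (D'.u i).val t = (D.u i).val t ∧ (D'.b i).val t = (D.b i).val t := by
  have hTT : T ∈ Icc 0 T := ⟨hT.le, le_rfl⟩
  have hint : ∀ {f g : StrongScalar L₁ L₂ T}, f.val 0 = g.val 0 → ∀ t ∈ Icc 0 T,
      f.val t - g.val t = ∫ s in (0 : ℝ)..t, (f.dt s - g.dt s) := by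
    intro f g h0 t ht
    rw [intervalIntegral.integral_sub (f.intervalIntegrable_dt ht) (g.intervalIntegrable_dt ht),
      f.val_eq_integral t ht, g.val_eq_integral t ht, h0]
    abel
  have hg : IntervalIntegrable (fun t => (βu + βb) * |c₂| + min μ₂ ν +
      2 * energyConst L₁ L₂ (min μ₂ ν) * F₁.coeffSize t) volume 0 T := by
    rw [intervalIntegrable_iff_integrableOn_Ioo_of_le hT.le]
    exact (integrable_const _).add (F₁.integrable_coeffSize.const_mul _)
  -- All four components enter one energy, because the magnetic cancellation couples the equations
  -- for u and b.
  have hz := eq_zero_of_inner_le (ι := Fin 2 ⊕ Fin 2)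
    (v := Sum.elim (fun i t => (D'.u i).val t - (D.u i).val t)
      (fun i t => (D'.b i).val t - (D.b i).val t))
    (d := Sum.elim (fun i t => (D'.u i).dt t - (D.u i).dt t)
      (fun i t => (D'.b i).dt t - (D.b i).dt t)) hT.le
    (by
      rintro (i | i)
      · exact ((D'.u i).intervalIntegrable_dt hTT).sub ((D.u i).intervalIntegrable_dt hTT)
      · exact ((D'.b i).intervalIntegrable_dt hTT).sub ((D.b i).intervalIntegrable_dt hTT))
    (by
      rintro (i | i)
      · exact hint (by rw [hD.initial_u, hD'.initial_u])
      · exact hint (by rw [hD.initial_b, hD'.initial_b]))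
    hg (by
      filter_upwards [hD.inner_le hL₁ hL₂ hμ₂ hν hβu hβb hI h₂ hD'] with t ht
      simpa only [Fintype.sum_sum_type, Sum.elim_inl, Sum.elim_inr, ← Finset.sum_add_distrib]
        using ht)
  exact fun t ht i => ⟨sub_eq_zero.1 (hz (Sum.inl i) t ht), sub_eq_zero.1 (hz (Sum.inr i) t ht)⟩

end Solutions

end PEM

end

/-! ### Existence, formula and uniqueness -/

theorem mainTheorem5
    (L₁ L₂ T : ℝ) (hL₁ : 0 < L₁) (hL₂ : 0 < L₂) (hT : 0 < T)
    (μ μ₁ μ₂ ν βu βb : ℝ) (hμ : 0 < μ) (hμ₁ : 0 < μ₁) (hμ₂ : 0 < μ₂) (hμ₁₂ : μ₁ ≠ μ₂)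
    (hν : 0 < ν) (hβu : 0 < βu) (hβb : 0 < βb)
    (c₁ c₂ h : ℝ) (hh : 0 < h)
    (I : PEM.LTwo L₁ L₂ →ₗ[ℝ] PEM.LTwo L₁ L₂) (hI : PEM.IsInterpolant c₁ c₂ h I)
    (R F₁ F₂ : PEM.Fields L₁ L₂ T)
    (hR : PEM.IsReferenceSolution μ ν R)
    (hF₁ : PEM.IsAssimilationSolution μ₁ ν βu βb I R F₁)
    (hF₂ : PEM.IsAssimilationSolution μ₂ ν βu βb I R F₂) :
    ∃ D : PEM.Fields L₁ L₂ T,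
      PEM.IsDifferenceQuotientSolution μ₁ μ₂ ν βu βb I F₁ F₂ D ∧
      (∀ t ∈ Set.Icc 0 T, ∀ i,
        (D.u i).val t = (μ₁ - μ₂)⁻¹ • ((F₁.u i).val t - (F₂.u i).val t) ∧
        (D.b i).val t = (μ₁ - μ₂)⁻¹ • ((F₁.b i).val t - (F₂.b i).val t)) ∧
      ∀ D' : PEM.Fields L₁ L₂ T,
        PEM.IsDifferenceQuotientSolution μ₁ μ₂ ν βu βb I F₁ F₂ D' →
        ∀ t ∈ Set.Icc 0 T, ∀ i,
          (D'.u i).val t = (D.u i).val t ∧ (D'.b i).val t = (D.b i).val t := by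
  have hD := hF₁.isDifferenceQuotientSolution hμ₁₂ hF₂
  exact ⟨_, hD, fun _ _ _ => ⟨rfl, rfl⟩, fun D' hD' =>
    hD.unique hL₁ hL₂ hT hμ₂ hν hβu hβb hI hF₂.constrained hD'⟩
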